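/- Let $G$ be a locally compact (Hausdorff) group with a left Haar measure $dx$, let $H$ be a compact subgroup of $G$ with its normalized Haar measure $dh$, and let $m$ be the normalized $G$-invariant Radon measure on the space $G/H$ of left cosets, i.e. the one that satisfies Weil's formula $\int_{G/H}\int_H f(xh)\,dh\,dm(xH)=\int_G f(x)\,dx$ for all $f\in C_c(G)$. Let $\varphi:\mathbb R\to[0,\infty)$ be a finite-valued Young function (convex, even, left continuous on $(0,\infty)$, $\varphi(0)=0$, $\varphi(x)\to\infty$ as $x\to\infty$) that satisfies the $\Delta_2$-condition: there are constants $C>0$ and $x_0>0$ such that $\varphi(2x)\le C\varphi(x)$ for all $x\ge x_0$ if $m(G/H)<\infty$, and there is a constant $C>0$ such that $\varphi(2x)\le C\varphi(x)$ for all $x\ge 0$ otherwise. Let $L^\varphi(G/H,m)$ be the Orlicz space of (classes of) measurable functions $g:G/H\to\mathbb C$ such that $\int_{G/H}\varphi(a|g|)\,dm<\infty$ for some $a>0$, with the Luxemburg norm $\|g\|_\varphi=\inf\{k>0:\int_{G/H}\varphi(|g|/k)\,dm\le1\}$. For $f,g\in C_c(G/H)$ put $$Jg(xH)=\int_H g(hxH)\,dh,\qquad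 (f*_{G/H}g)(xH)=\int_{G/H}f(yH)\,Jg(y^{-1}xH)\,dm(yH).$$ Then $J$ has a unique extension to a bounded linear operator $J_\varphi$ on $L^\varphi(G/H,m)$, and there is a unique map $*^\varphi_{G/H}:L^1(G/H,m)\times L^\varphi(G/H,m)\to L^\varphi(G/H,m)$ such that $f*^\varphi_{G/H}g=\lim_n f_n*_{G/H}g_n$ in $L^\varphi(G/H,m)$ for all sequences $f_n,g_n\in C_c(G/H)$ with $f_n\to f$ in $L^1(G/H,m)$ and $g_n\to g$ in $L^\varphi(G/H,m)$. Moreover, for all $f\in L^1(G/H,m)$ and $g\in L^\varphi(G/H,m)$, the class $J_\varphi g$ has a representative that is left $H$-invariant (its value at $hxH$ equals its value at $xH$ for all $h\in H$ and $x\in G$), and for every such representative, again written $J_\varphi g$, and for $m$-almost every $xH\in G/H$, the function $yH\mapsto f(yH)\,J_\varphi g(y^{-1}xH)$ is $m$-integrable and $$(f*^\varphi_{G/H}g)(xH)=\int_{G/H}f(yH)\,J_\varphi g(y^{-1}xH)\,dm(yH).$$ -/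

import Mathlib

open MeasureTheory Filter Topology Set
open scoped ENNReal NNReal CompactlySupported

namespace OrliczCoset

/-- A Young function: a convex even function `φ : ℝ → [0, ∞]` with `φ 0 = 0` and
`φ x → ∞` as `x → ∞`, left continuous on the half line `(0, ∞)` (which determines `φ`, as `φ` is
even). It is not the zero function because of its limit at infinity. -/
structure YoungFunction where
  toFun : ℝ → ℝ≥0∞
  convex : ConvexOn ℝ≥0 univ toFun
  even : ∀ x, toFun (-x) = toFun x
  leftCont : ∀ x, 0 < x → ContinuousWithinAt toFun (Iio x) x
  map_zero : toFun 0 = 0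
  tendsto_top : Tendsto toFun atTop (𝓝 ∞)

/-- A Young function is nondecreasing on `[0, ∞)`. -/
theorem YoungFunction.mono (φ : YoungFunction) {x y : ℝ} (hx : 0 ≤ x) (hxy : x ≤ y) :
    φ.toFun x ≤ φ.toFun y := by
  rcases hx.eq_or_lt with rfl | hx0
  · simp [φ.map_zero]
  have hy : 0 < y := hx0.trans_le hxy
  obtain ⟨t, ht⟩ : ∃ t : ℝ≥0, (t : ℝ) = x / y := ⟨(x / y).toNNReal,
    Real.coe_toNNReal _ (by positivity)⟩
  have h1 : t ≤ 1 := by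
    rw [← NNReal.coe_le_coe, ht]
    exact (div_le_one hy).2 hxy
  have hconv := φ.convex.2
  have key := hconv (mem_univ y) (mem_univ 0) (zero_le : 0 ≤ t) (zero_le : 0 ≤ 1 - t)
    (add_tsub_cancel_of_le h1)
  rw [φ.map_zero, smul_zero, smul_zero, add_zero, add_zero] at key
  have e : (t • y : ℝ) = x := by
    rw [NNReal.smul_def, ht, smul_eq_mul]
    field_simp
  rw [e] at key
  refine key.trans ?_
  rw [ENNReal.smul_def, smul_eq_mul]
  exact mul_le_of_le_one_left zero_le (by exact_mod_cast h1)

/-- Midpoint convexity. -/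
theorem YoungFunction.midpoint (φ : YoungFunction) (x y : ℝ) :
    φ.toFun ((x + y) / 2) ≤ φ.toFun x + φ.toFun y := by
  have hconv := φ.convex.2
  have key := hconv (mem_univ x) (mem_univ y) (zero_le : (0 : ℝ≥0) ≤ 1 / 2) (zero_le : (0 : ℝ≥0) ≤ 1 / 2)
    (by ext; norm_num)
  have e : ((1 / 2 : ℝ≥0) • x + (1 / 2 : ℝ≥0) • y : ℝ) = (x + y) / 2 := by
    simp only [NNReal.smul_def, smul_eq_mul]
    push_cast
    ring
  rw [e] at key
  refine key.trans (add_le_add ?_ ?_) <;>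
  · rw [ENNReal.smul_def, smul_eq_mul]
    refine mul_le_of_le_one_left zero_le ?_
    exact_mod_cast (show (1 / 2 : ℝ≥0) ≤ 1 by norm_num)

section Orlicz

/-- The `Δ₂`-condition for `φ` relative to the measure `m`: `φ (2 x) ≤ C φ x` for all large `x` if
`m` is finite, and for all `x ≥ 0` otherwise. -/
def DeltaTwo {X : Type*} [MeasurableSpace X] (φ : YoungFunction) (m : Measure X) : Prop :=
  (m univ < ∞ → ∃ C : ℝ≥0, 0 < C ∧ ∃ x₀ : ℝ, 0 < x₀ ∧
    ∀ x, x₀ ≤ x → φ.toFun (2 * x) ≤ C * φ.toFun x) ∧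
  (m univ = ∞ → ∃ C : ℝ≥0, 0 < C ∧ ∀ x, 0 ≤ x → φ.toFun (2 * x) ≤ C * φ.toFun x)

/-- The modular `ρ_φ(f) = ∫ φ(|f|) dm`. -/
noncomputable def modular {X : Type*} [MeasurableSpace X] (φ : YoungFunction) (m : Measure X)
    (f : X → ℂ) : ℝ≥0∞ :=
  ∫⁻ x, φ.toFun ‖f x‖ ∂m

/-- The Luxemburg norm `inf {k > 0 : ρ_φ(f / k) ≤ 1}`, with values in `[0, ∞]` (it is `∞` when
there is no such `k`). -/
noncomputable def luxemburgNorm {X : Type*} [MeasurableSpace X] (φ : YoungFunction)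
    (m : Measure X) (f : X → ℂ) : ℝ≥0∞ :=
  sInf (ENNReal.ofReal '' {k : ℝ | 0 < k ∧ modular φ m (fun x => f x / (k : ℂ)) ≤ 1})

/-- The Orlicz space `L^φ(X, m)`: the classes `f` of measurable functions modulo equality
`m`-almost everywhere such that `ρ_φ(a f) < ∞` for some `a > 0`. -/
noncomputable def orliczSpace {X : Type*} [MeasurableSpace X] (φ : YoungFunction)
    (m : Measure X) : Submodule ℂ (X →ₘ[m] ℂ) where
  carrier := {f | ∃ a : ℝ, 0 < a ∧ modular φ m (fun x => (a : ℂ) * f x) < ∞}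
  zero_mem' := by
    refine ⟨1, one_pos, ?_⟩
    have : modular φ m (fun x => ((1 : ℝ) : ℂ) * (0 : X →ₘ[m] ℂ) x) = ∫⁻ _, 0 ∂m := by
      refine lintegral_congr_ae ?_
      filter_upwards [AEEqFun.coeFn_zero (μ := m) (β := ℂ) (α := X)] with x hx
      simp [hx, φ.map_zero]
    rw [this]
    simp
  add_mem' := by
    rintro f g ⟨a, ha, hf⟩ ⟨b, hb, hg⟩
    refine ⟨min a b / 2, by positivity, ?_⟩
    have hmeas : AEMeasurable (fun x => φ.toFun ‖(a : ℂ) * f x‖) m := by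
      have hm : Monotone (fun t : ℝ => φ.toFun (max t 0)) := fun s t hst =>
        φ.mono (le_max_right _ _) (max_le_max_right _ hst)
      have h2 : AEMeasurable (fun x => ‖(a : ℂ) * f x‖) m :=
        (f.aestronglyMeasurable.aemeasurable.const_mul _).norm
      have h3 := hm.measurable.comp_aemeasurable h2
      refine h3.congr (Eventually.of_forall fun x => ?_)
      simp only [Function.comp]
      rw [max_eq_left (norm_nonneg _)]
    refine lt_of_le_of_lt ?_ (ENNReal.add_lt_top.2 ⟨hf, hg⟩)
    unfold modular
    rw [← lintegral_add_left' hmeas]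
    refine lintegral_mono_ae ?_
    filter_upwards [AEEqFun.coeFn_add f g] with x hx
    rw [hx, Pi.add_apply]
    refine le_trans ?_ (φ.midpoint _ _)
    refine φ.mono (norm_nonneg _) ?_
    rw [norm_mul, norm_mul, norm_mul, Complex.norm_real, Complex.norm_real, Complex.norm_real,
      Real.norm_of_nonneg ha.le, Real.norm_of_nonneg hb.le,
      Real.norm_of_nonneg (by positivity : 0 ≤ min a b / 2)]
    have h1 := norm_add_le (f x) (g x)
    have h2 := mul_le_mul_of_nonneg_right (min_le_left a b) (norm_nonneg (f x))
    have h3 := mul_le_mul_of_nonneg_right (min_le_right a b) (norm_nonneg (g x))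
    have h4 := mul_le_mul_of_nonneg_left h1 (le_min ha.le hb.le)
    linarith
  smul_mem' := by
    rintro c f ⟨a, ha, hf⟩
    refine ⟨a / (‖c‖ + 1), by positivity, lt_of_le_of_lt ?_ hf⟩
    refine lintegral_mono_ae ?_
    filter_upwards [AEEqFun.coeFn_smul c f] with x hx
    rw [hx, Pi.smul_apply, smul_eq_mul]
    refine φ.mono (norm_nonneg _) ?_
    rw [norm_mul, norm_mul, norm_mul, Complex.norm_real, Complex.norm_real,
      Real.norm_of_nonneg ha.le, Real.norm_of_nonneg (by positivity : 0 ≤ a / (‖c‖ + 1))]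
    have h1 : a / (‖c‖ + 1) * ‖c‖ ≤ a := by
      rw [div_mul_eq_mul_div, div_le_iff₀ (by positivity)]
      nlinarith [norm_nonneg c]
    calc a / (‖c‖ + 1) * (‖c‖ * ‖f x‖) = a / (‖c‖ + 1) * ‖c‖ * ‖f x‖ := by ring
      _ ≤ a * ‖f x‖ := mul_le_mul_of_nonneg_right h1 (norm_nonneg _)

end Orlicz

section Coset

/-- The normalized Haar measure `dh` of the compact group `H`. -/
noncomputable def haarProb {G : Type*} [Group G] [TopologicalSpace G] [IsTopologicalGroup G]
    [MeasurableSpace G] [BorelSpace G] (H : Subgroup G) [CompactSpace H] : Measure H :=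
  Measure.haarMeasure (⊤ : TopologicalSpace.PositiveCompacts H)

/-- `T_H f (xH) = ∫_H f (x h) dh`. -/
noncomputable def cosetAverage {G : Type*} [Group G] [TopologicalSpace G] [IsTopologicalGroup G]
    [MeasurableSpace G] [BorelSpace G] (H : Subgroup G) [CompactSpace H] (f : G → ℂ) :
    G ⧸ H → ℂ := fun z =>
  Quotient.liftOn' z (fun x => ∫ h : H, f (x * (h : G)) ∂(haarProb H)) (by
    intro x y hxy
    rw [QuotientGroup.leftRel_apply] at hxy
    have h1 := integral_mul_left_eq_self (μ := Measure.haarMeasure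
      (⊤ : TopologicalSpace.PositiveCompacts H)) (fun h : H => f (x * (h : G))) ⟨x⁻¹ * y, hxy⟩
    simp only [haarProb]
    rw [← h1]
    simp [mul_assoc])

/-- Weil's formula `∫_{G/H} T_H f dm = ∫_G f dμ` for all `f ∈ C_c(G)`. -/
def WeilFormula {G : Type*} [Group G] [TopologicalSpace G] [IsTopologicalGroup G]
    [MeasurableSpace G] [BorelSpace G] (μ : Measure G) (H : Subgroup G) [CompactSpace H]
    [MeasurableSpace (G ⧸ H)] (m : Measure (G ⧸ H)) : Prop :=
  ∀ f : C_c(G, ℂ), ∫ z, cosetAverage H f z ∂m = ∫ x, f x ∂μ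

/-- A function on `G/H` is left `H`-invariant if `F (h xH) = F (xH)` for all `h ∈ H` and all
`xH`. -/
def LeftInvariant {G : Type*} [Group G] (H : Subgroup G) (F : G ⧸ H → ℂ) : Prop :=
  ∀ (h : H) (z : G ⧸ H), F ((h : G) • z) = F z

/-- A compact group is unimodular. -/
instance haarProb_isMulRightInvariant {G : Type*} [Group G] [TopologicalSpace G]
    [IsTopologicalGroup G] [MeasurableSpace G] [BorelSpace G] (H : Subgroup G) [CompactSpace H] :
    (haarProb H).IsMulRightInvariant := by
  have : (haarProb H).IsHaarMeasure := by unfold haarProb; infer_instance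
  have : (haarProb H).Regular := by unfold haarProb; infer_instance
  have hp : IsProbabilityMeasure (haarProb H) := ⟨by
    simpa [haarProb] using Measure.haarMeasure_self
      (K₀ := (⊤ : TopologicalSpace.PositiveCompacts H))⟩
  refine ⟨fun k => ?_⟩
  have : IsProbabilityMeasure (Measure.map (· * k) (haarProb H)) :=
    Measure.isProbabilityMeasure_map (measurable_mul_const k).aemeasurable
  have : (Measure.map (· * k) (haarProb H)).Regular :=
    Measure.Regular.map (Homeomorph.mulRight k)
  exact Measure.isHaarMeasure_eq_of_isProbabilityMeasure _ _

/-- `J g (xH) = ∫_H g (h xH) dh`. -/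
noncomputable def average {G : Type*} [Group G] [TopologicalSpace G] [IsTopologicalGroup G]
    [MeasurableSpace G] [BorelSpace G] (H : Subgroup G) [CompactSpace H] (g : G ⧸ H → ℂ) :
    G ⧸ H → ℂ := fun z =>
  ∫ h : H, g ((h : G) • z) ∂(haarProb H)

theorem average_leftInvariant {G : Type*} [Group G] [TopologicalSpace G] [IsTopologicalGroup G]
    [MeasurableSpace G] [BorelSpace G] (H : Subgroup G) [CompactSpace H] (g : G ⧸ H → ℂ) :
    LeftInvariant H (average H g) := by
  intro k z
  have h1 := integral_mul_right_eq_self (μ := haarProb H) (fun h : H => g ((h : G) • z)) k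
  simp only [average]
  rw [← h1]
  simp [mul_smul]

/-- For a left `H`-invariant function `F` on `G/H` and a fixed `z = xH`, the function
`yH ↦ F (y⁻¹ xH)` on `G/H`; it is well defined because `F` is left `H`-invariant. -/
def translate {G : Type*} [Group G] (H : Subgroup G) (F : G ⧸ H → ℂ) (hF : LeftInvariant H F)
    (z : G ⧸ H) : G ⧸ H → ℂ := fun w =>
  Quotient.liftOn' w (fun y => F (y⁻¹ • z)) (by
    intro x y hxy
    rw [QuotientGroup.leftRel_apply] at hxy
    have h1 := hF ⟨x⁻¹ * y, hxy⟩ (y⁻¹ • z)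
    rw [← h1, smul_smul]
    simp)

/-- The convolution `(f * g)(xH) = ∫_{G/H} f (yH) J g (y⁻¹ xH) dm(yH)` of functions on `G/H`. -/
noncomputable def conv {G : Type*} [Group G] [TopologicalSpace G] [IsTopologicalGroup G]
    [MeasurableSpace G] [BorelSpace G] (H : Subgroup G) [CompactSpace H]
    [MeasurableSpace (G ⧸ H)] (m : Measure (G ⧸ H)) (f g : G ⧸ H → ℂ) : G ⧸ H → ℂ := fun z =>
  ∫ w, f w * translate H (average H g) (average_leftInvariant H g) z w ∂m

/-- `T` is a bounded linear operator on `L^φ(G/H, m)` which extends `J : C_c(G/H) → C_c(G/H)`. -/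
def IsAverageExtension {G : Type*} [Group G] [TopologicalSpace G] [IsTopologicalGroup G]
    [MeasurableSpace G] [BorelSpace G] (H : Subgroup G) [CompactSpace H]
    [MeasurableSpace (G ⧸ H)] (m : Measure (G ⧸ H)) (φ : YoungFunction)
    (T : orliczSpace φ m →ₗ[ℂ] orliczSpace φ m) : Prop :=
  (∃ C : ℝ≥0, ∀ g : orliczSpace φ m,
    luxemburgNorm φ m (T g).1 ≤ C * luxemburgNorm φ m g.1) ∧
  ∀ (k : C_c(G ⧸ H, ℂ)) (g : orliczSpace φ m), g.1 =ᵐ[m] k → (T g).1 =ᵐ[m] average H k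

/-- `B` is the extension of the convolution of `C_c(G/H)` to `L^1(G/H, m) × L^φ(G/H, m)` by
limits: `B f g = lim fₙ * gₙ` in `L^φ(G/H, m)` for all sequences `fₙ`, `gₙ` in `C_c(G/H)` such
that `fₙ → f` in `L^1(G/H, m)` and `gₙ → g` in `L^φ(G/H, m)`. -/
def IsConvExtension {G : Type*} [Group G] [TopologicalSpace G] [IsTopologicalGroup G]
    [MeasurableSpace G] [BorelSpace G] (H : Subgroup G) [CompactSpace H]
    [MeasurableSpace (G ⧸ H)] (m : Measure (G ⧸ H)) (φ : YoungFunction)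
    (B : Lp ℂ 1 m → orliczSpace φ m → orliczSpace φ m) : Prop :=
  ∀ (f : Lp ℂ 1 m) (g : orliczSpace φ m) (fn gn : ℕ → C_c(G ⧸ H, ℂ)),
    Tendsto (fun n => eLpNorm (fun z => fn n z - f z) 1 m) atTop (𝓝 0) →
    Tendsto (fun n => luxemburgNorm φ m (fun z => gn n z - g.1 z)) atTop (𝓝 0) →
    Tendsto (fun n => luxemburgNorm φ m (fun z => conv H m (fn n) (gn n) z - (B f g).1 z))
      atTop (𝓝 0)

end Coset

end OrliczCoset

set_option linter.unusedSectionVars false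
set_option linter.overlappingInstances false

namespace OrliczCoset

/-! Everything rests on Minkowski's inequality for the Luxemburg norm (`elux_lintegral_le`): if
every function of a family indexed by a finite measure space `(Ω, ν)` has norm at most `L`, then the
integral of the family has norm at most `ν(Ω) L`. It follows from Jensen's inequality and an
interchange of integrals. A weighted counting measure turns it into the countable triangle
inequality, `dh` gives `‖Jg‖ ≤ ‖g‖`, and `|f| dm` gives Young's inequality `‖f * g‖ ≤ ‖f‖₁ ‖g‖`.

Since `φ` is finite and satisfies `Δ₂`, `C_c(G/H)` is dense in `L^φ`, which is complete. Hence `J`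
and the convolution extend uniquely by these bounds. The space `L¹` is treated as the Orlicz space
of `|x|`.

For the integral formula, approximate `f` and `g` by `f_n` and `g_n` in `C_c(G/H)` with summable
errors. The countable triangle inequality then yields almost everywhere convergence of `f_n` and `J
g_n`. It also yields a majorant: by Young's inequality the double series of the products of the
increments of `f_n` and of the translated `J g_n` is integrable in `yH` for almost every `xH`.
Dominated convergence identifies the limit of `(f_n * g_n)(xH)` along a subsequence. One point
remains: `J g_n (y⁻¹xH)` must converge for almost every `yH`, so exceptional null sets have to
survive `y ↦ y⁻¹xH`. They are moved to `G` by Weil's formula, and there inversion preserves null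
sets.

No measure here is assumed σ-finite. Integrals are therefore interchanged only for sums and for
continuous compactly supported kernels, and null sets are transported by regularity. -/

/-- A Young function with finite values. -/
class YoungFunction.Finite (φ : YoungFunction) : Prop where
  ne_top : ∀ x, φ.toFun x ≠ ∞

/-! ### Finite Young functions on `[0, ∞]` and Jensen's inequality -/

namespace YoungFunction

variable (φ : YoungFunction)

/-- The real-valued function underlying a finite Young function. -/
noncomputable def real (x : ℝ) : ℝ := (φ.toFun x).toReal

theorem ofReal_real [φ.Finite] (x : ℝ) : ENNReal.ofReal (φ.real x) = φ.toFun x :=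
  ENNReal.ofReal_toReal (Finite.ne_top x)

theorem convexOn_real [φ.Finite] : ConvexOn ℝ univ φ.real := by
  refine ⟨convex_univ, fun x _ y _ a b ha hb hab => ?_⟩
  lift a to ℝ≥0 using ha
  lift b to ℝ≥0 using hb
  have h := φ.convex.2 (mem_univ x) (mem_univ y) (zero_le : 0 ≤ a) (zero_le : 0 ≤ b)
    (by exact_mod_cast hab)
  have h2 := ENNReal.toReal_mono (by
    simp [ENNReal.smul_def, ENNReal.mul_eq_top, Finite.ne_top]) h
  rw [ENNReal.toReal_add (by simp [ENNReal.smul_def, ENNReal.mul_eq_top, Finite.ne_top])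
    (by simp [ENNReal.smul_def, ENNReal.mul_eq_top, Finite.ne_top])] at h2
  simpa [real, ENNReal.smul_def, NNReal.smul_def] using h2

theorem continuous_real [φ.Finite] : Continuous φ.real :=
  continuousOn_univ.1 (φ.convexOn_real.continuousOn isOpen_univ)

theorem continuous_toFun [φ.Finite] : Continuous φ.toFun := by
  have : φ.toFun = fun x => ENNReal.ofReal (φ.real x) := funext fun x => (φ.ofReal_real x).symm
  rw [this]
  exact ENNReal.continuous_ofReal.comp φ.continuous_real

/-- The extension of a Young function to `[0, ∞]`. -/
noncomputable def ext (t : ℝ≥0∞) : ℝ≥0∞ := if t = ∞ then ∞ else φ.toFun t.toReal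

@[simp] theorem ext_top : φ.ext ∞ = ∞ := by simp [ext]

@[simp] theorem ext_zero : φ.ext 0 = 0 := by simp [ext, φ.map_zero]

theorem ext_of_ne_top {t : ℝ≥0∞} (ht : t ≠ ∞) : φ.ext t = φ.toFun t.toReal := by simp [ext, ht]

theorem ext_ofReal {x : ℝ} (hx : 0 ≤ x) : φ.ext (ENNReal.ofReal x) = φ.toFun x := by
  rw [ext_of_ne_top _ ENNReal.ofReal_ne_top, ENNReal.toReal_ofReal hx]

theorem ext_enorm (z : ℂ) : φ.ext ‖z‖ₑ = φ.toFun ‖z‖ := by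
  rw [← ofReal_norm, ext_ofReal _ (norm_nonneg _)]

theorem ext_mono : Monotone φ.ext := by
  intro s t hst
  by_cases ht : t = ∞
  · simp [ht]
  · rw [ext_of_ne_top _ ht, ext_of_ne_top _ (ne_top_of_le_ne_top ht hst)]
    exact φ.mono ENNReal.toReal_nonneg (ENNReal.toReal_mono ht hst)

theorem measurable_ext : Measurable φ.ext := φ.ext_mono.measurable

theorem exists_lt_ext {M : ℝ≥0∞} (hM : M < ∞) : ∃ x : ℝ, 0 < x ∧ M < φ.toFun x := by
  obtain ⟨x, hx, hx0⟩ := ((φ.tendsto_top.eventually (lt_mem_nhds hM)).and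
    (eventually_gt_atTop 0)).exists
  exact ⟨x, hx0, hx⟩

theorem ext_ne_top [φ.Finite] {t : ℝ≥0∞} (ht : t ≠ ∞) : φ.ext t ≠ ∞ := by
  rw [ext_of_ne_top _ ht]
  exact Finite.ne_top _

/-- At finite points this is the continuity of a finite convex function on the line; at `∞` it is
the divergence of `φ`. -/
theorem continuous_ext [φ.Finite] : Continuous φ.ext := by
  rw [continuous_iff_continuousAt]
  intro t
  by_cases ht : t = ∞
  · subst ht
    rw [ContinuousAt, ext_top, ENNReal.tendsto_nhds_top_iff_nnreal]
    intro M
    obtain ⟨x, hx, hM⟩ := φ.exists_lt_ext (M := M) ENNReal.coe_lt_top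
    filter_upwards [lt_mem_nhds (ENNReal.ofReal_lt_top (r := x))] with s hs
    refine hM.trans_le ?_
    rw [← φ.ext_ofReal hx.le]
    exact φ.ext_mono hs.le
  · have h : φ.ext =ᶠ[𝓝 t] fun s => φ.toFun s.toReal := by
      filter_upwards [gt_mem_nhds (lt_top_iff_ne_top.2 ht)] with s hs
      exact φ.ext_of_ne_top hs.ne
    refine ContinuousAt.congr ?_ h.symm
    exact φ.continuous_toFun.continuousAt.comp (ENNReal.tendsto_toReal ht)

theorem ext_mul_le {c t : ℝ≥0∞} (hc : c ≤ 1) : φ.ext (c * t) ≤ c * φ.ext t := by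
  by_cases hc0 : c = 0
  · simp [hc0]
  by_cases ht : t = ∞
  · simp [ht, ENNReal.mul_top hc0]
  lift c to ℝ≥0 using ne_top_of_le_ne_top ENNReal.one_ne_top hc
  lift t to ℝ≥0 using ht
  rw [ext_of_ne_top _ (by simp [ENNReal.mul_eq_top]), ext_of_ne_top _ (by simp)]
  have hc' : c ≤ 1 := by exact_mod_cast hc
  have key := φ.convex.2 (mem_univ (t : ℝ)) (mem_univ 0) (zero_le : 0 ≤ c)
    (zero_le : 0 ≤ 1 - c) (add_tsub_cancel_of_le hc')
  rw [φ.map_zero, smul_zero, smul_zero, add_zero, add_zero] at key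
  simpa [NNReal.smul_def, ENNReal.smul_def] using key

/-- The bound `N` makes `u` and `φ ∘ u` integrable, so that the real-valued Jensen inequality
applies. -/
theorem jensen_of_le [φ.Finite] {Ω : Type*} [MeasurableSpace Ω] {P : Measure Ω}
    [IsProbabilityMeasure P] {u : Ω → ℝ≥0∞} (hu : AEMeasurable u P) (N : ℕ) (hN : ∀ ω, u ω ≤ N) :
    φ.ext (∫⁻ ω, u ω ∂P) ≤ ∫⁻ ω, φ.ext (u ω) ∂P := by
  have hfin : ∀ ω, u ω ≠ ∞ := fun ω => ne_top_of_le_ne_top (ENNReal.natCast_ne_top N) (hN ω)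
  have hle : ∀ ω, (u ω).toReal ≤ N := fun ω => ENNReal.toReal_le_of_le_ofReal (by simp)
    (by simpa using hN ω)
  have hmono : ∀ {x y : ℝ}, 0 ≤ x → x ≤ y → φ.real x ≤ φ.real y := fun hx hxy =>
    ENNReal.toReal_mono (Finite.ne_top _) (φ.mono hx hxy)
  have i1 : Integrable (fun ω => (u ω).toReal) P := by
    refine Integrable.of_bound hu.ennreal_toReal.aestronglyMeasurable N ?_
    exact Eventually.of_forall fun ω => by simpa using hle ω
  have i2 : Integrable (φ.real ∘ fun ω => (u ω).toReal) P := by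
    refine Integrable.of_bound (φ.continuous_real.comp_aestronglyMeasurable i1.1) (φ.real N) ?_
    refine Eventually.of_forall fun ω => ?_
    rw [Function.comp_apply, Real.norm_of_nonneg (show 0 ≤ φ.real _ from ENNReal.toReal_nonneg)]
    exact hmono ENNReal.toReal_nonneg (hle ω)
  have key := φ.convexOn_real.map_integral_le φ.continuous_real.continuousOn isClosed_univ
    (Eventually.of_forall fun _ => mem_univ _) i1 i2
  have e1 := ofReal_integral_eq_lintegral_ofReal i1
    (Eventually.of_forall fun _ => ENNReal.toReal_nonneg)
  have e2 := ofReal_integral_eq_lintegral_ofReal i2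
    (Eventually.of_forall fun _ => ENNReal.toReal_nonneg)
  simp only [ENNReal.ofReal_toReal (hfin _)] at e1
  simp only [Function.comp, ofReal_real] at e2
  rw [← e1, φ.ext_ofReal (integral_nonneg fun _ => ENNReal.toReal_nonneg), ← φ.ofReal_real]
  refine (ENNReal.ofReal_le_ofReal key).trans ?_
  rw [e2]
  exact lintegral_mono fun ω => (φ.ext_of_ne_top (hfin ω)).ge

/-- Truncate at `n` and let `n` grow: monotone convergence on the left, with the supremum passing
through `φ.ext` by continuity. Infinite values and infinite integrals are thus allowed. -/
theorem jensen [φ.Finite] {Ω : Type*} [MeasurableSpace Ω] {P : Measure Ω}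
    [IsProbabilityMeasure P] {u : Ω → ℝ≥0∞} (hu : AEMeasurable u P) :
    φ.ext (∫⁻ ω, u ω ∂P) ≤ ∫⁻ ω, φ.ext (u ω) ∂P := by
  have e : ∫⁻ ω, u ω ∂P = ⨆ n : ℕ, ∫⁻ ω, min (u ω) n ∂P := by
    rw [← lintegral_iSup' (fun n => hu.min aemeasurable_const)]
    · refine lintegral_congr fun ω => ?_
      rw [← inf_iSup_eq, ENNReal.iSup_natCast, inf_top_eq]
    · exact Eventually.of_forall fun ω i j hij => by
        dsimp only
        gcongr
  rw [e, φ.ext_mono.map_iSup_of_continuousAt φ.continuous_ext.continuousAt (by simp)]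
  refine iSup_le fun n => ?_
  refine (φ.jensen_of_le (hu.min aemeasurable_const) n fun ω => min_le_right _ _).trans ?_
  exact lintegral_mono fun ω => φ.ext_mono (min_le_left _ _)

end YoungFunction

/-! ### The Luxemburg functional on `[0, ∞]`-valued functions and Minkowski's inequality -/

section Elux

variable {X : Type*} [MeasurableSpace X] (φ : YoungFunction) (m : Measure X)

/-- The Luxemburg norm of a function with values in `[0, ∞]`. -/
noncomputable def elux (u : X → ℝ≥0∞) : ℝ≥0∞ :=
  sInf {k : ℝ≥0∞ | k ≠ 0 ∧ ∫⁻ x, φ.ext (u x / k) ∂m ≤ 1}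

variable {φ m}

theorem elux_le {u : X → ℝ≥0∞} {k : ℝ≥0∞} (hk : k ≠ 0) (h : ∫⁻ x, φ.ext (u x / k) ∂m ≤ 1) :
    elux φ m u ≤ k := sInf_le ⟨hk, h⟩

theorem lintegral_le_one_of_elux_lt {u : X → ℝ≥0∞} {k : ℝ≥0∞} (h : elux φ m u < k) :
    ∫⁻ x, φ.ext (u x / k) ∂m ≤ 1 := by
  obtain ⟨l, ⟨_, hl⟩, hlk⟩ := sInf_lt_iff.1 h
  refine le_trans (lintegral_mono fun x => φ.ext_mono ?_) hl
  gcongr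

theorem elux_mono_ae {u v : X → ℝ≥0∞} (h : u ≤ᵐ[m] v) : elux φ m u ≤ elux φ m v := by
  refine le_of_forall_gt fun k hk => ?_
  obtain ⟨l, hl, hlk⟩ := exists_between hk
  refine lt_of_le_of_lt (elux_le (pos_of_gt hl).ne' ?_) hlk
  refine le_trans (lintegral_mono_ae ?_) (lintegral_le_one_of_elux_lt hl)
  filter_upwards [h] with x hx
  exact φ.ext_mono (by gcongr)

theorem elux_mono {u v : X → ℝ≥0∞} (h : ∀ x, u x ≤ v x) : elux φ m u ≤ elux φ m v :=
  elux_mono_ae (Eventually.of_forall h)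

theorem elux_congr_ae {u v : X → ℝ≥0∞} (h : u =ᵐ[m] v) : elux φ m u = elux φ m v :=
  (elux_mono_ae h.le).antisymm (elux_mono_ae h.symm.le)

@[simp] theorem elux_zero : elux φ m (fun _ => 0) = 0 := by
  refine le_antisymm (ENNReal.le_of_forall_pos_le_add fun ε hε _ => ?_) zero_le
  rw [zero_add]
  exact elux_le (by simpa using hε.ne') (by simp)

theorem elux_const_mul_le (c : ℝ≥0∞) (hc : c ≠ ∞) (u : X → ℝ≥0∞) :
    elux φ m (fun x => c * u x) ≤ c * elux φ m u := by
  by_cases hc0 : c = 0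
  · simp [hc0]
  rw [mul_comm _ (elux φ m u), ← ENNReal.div_le_iff_le_mul (Or.inl hc0) (Or.inl hc)]
  refine le_of_forall_gt fun k hk => ?_
  obtain ⟨l, hl, hlk⟩ := exists_between hk
  refine lt_of_le_of_lt ?_ hlk
  have hl0 : l ≠ 0 := (pos_of_gt hl).ne'
  rw [ENNReal.div_le_iff_le_mul (Or.inl hc0) (Or.inl hc)]
  refine elux_le (mul_ne_zero hl0 hc0) (le_trans (lintegral_mono fun x => φ.ext_mono ?_)
    (lintegral_le_one_of_elux_lt hl))
  rw [mul_comm l c, ENNReal.mul_div_mul_left _ _ hc0 hc]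

theorem elux_const_mul (c : ℝ≥0∞) (hc : c ≠ ∞) (u : X → ℝ≥0∞) :
    elux φ m (fun x => c * u x) = c * elux φ m u := by
  refine (elux_const_mul_le c hc u).antisymm ?_
  by_cases hc0 : c = 0
  · simp [hc0]
  have h := elux_const_mul_le (φ := φ) (m := m) c⁻¹ (by simpa using hc0) (fun x => c * u x)
  simp only [← mul_assoc, ENNReal.inv_mul_cancel hc0 hc, one_mul] at h
  calc c * elux φ m u ≤ c * (c⁻¹ * elux φ m fun x => c * u x) := by gcongr
    _ = _ := by rw [← mul_assoc, ENNReal.mul_inv_cancel hc0 hc, one_mul]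

/-- A finite modular forces `φ.ext (u / k) < ∞` almost everywhere, and `φ.ext ∞ = ∞`. Applied to
infinite series, this is the source of all almost everywhere convergence below. -/
theorem ae_lt_top_of_elux_lt_top {u : X → ℝ≥0∞} (hu : AEMeasurable u m) (h : elux φ m u < ∞) :
    ∀ᵐ x ∂m, u x < ∞ := by
  obtain ⟨k, hk, hk'⟩ := exists_between h
  have h1 := lintegral_le_one_of_elux_lt hk
  have h2 := ae_lt_top' (φ.measurable_ext.comp_aemeasurable (hu.div_const k))
    (ne_top_of_le_ne_top ENNReal.one_ne_top h1)
  filter_upwards [h2] with x hx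
  by_contra hcon
  rw [not_lt, top_le_iff] at hcon
  simp [hcon, ENNReal.top_div_of_ne_top hk'.ne] at hx

/-- Minkowski's inequality: Jensen for the probability measure `ν / ν(Ω)` bounds the modular of the
integral by the mean of the modulars. The interchange of integrals is the hypothesis `swap`, because
`m` need not be σ-finite; each application supplies its own reason for it. -/
theorem elux_lintegral_le [φ.Finite] {Ω : Type*} [MeasurableSpace Ω] {ν : Measure Ω}
    [IsFiniteMeasure ν] {b : Ω → X → ℝ≥0∞} (hb : ∀ x, AEMeasurable (fun ω => b ω x) ν)
    {L : ℝ≥0∞} (hL : ∀ ω, elux φ m (b ω) ≤ L)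
    (swap : ∀ k : ℝ≥0∞, k ≠ 0 → k ≠ ∞ → ∫⁻ x, ∫⁻ ω, φ.ext (b ω x / k) ∂ν ∂m ≤
      ∫⁻ ω, ∫⁻ x, φ.ext (b ω x / k) ∂m ∂ν) :
    elux φ m (fun x => ∫⁻ ω, b ω x ∂ν) ≤ ν univ * L := by
  by_cases hν : ν univ = 0
  · simp [Measure.measure_univ_eq_zero.1 hν]
  have hν' : ν univ ≠ ∞ := measure_ne_top ν univ
  rw [mul_comm, ← ENNReal.div_le_iff_le_mul (Or.inl hν) (Or.inl hν')]
  refine le_of_forall_gt fun l hl => ?_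
  obtain ⟨k, hk, hkl⟩ := exists_between hl
  refine lt_of_le_of_lt ?_ hkl
  have hk0 : k ≠ 0 := (pos_of_gt hk).ne'
  have hkt : k ≠ ∞ := (hkl.trans_le le_top).ne
  rw [ENNReal.div_le_iff_le_mul (Or.inl hν) (Or.inl hν')]
  refine elux_le (mul_ne_zero hk0 hν) ?_
  let P : Measure Ω := (ν univ)⁻¹ • ν
  have : NeZero ν := ⟨fun h => hν (by simp [h])⟩
  have hP : IsProbabilityMeasure P := by
    refine ⟨?_⟩
    simp only [P, Measure.smul_apply, smul_eq_mul]
    exact ENNReal.inv_mul_cancel hν hν'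
  have h1 : ∀ x, φ.ext ((∫⁻ ω, b ω x ∂ν) / (k * ν univ)) ≤
      (ν univ)⁻¹ * ∫⁻ ω, φ.ext (b ω x / k) ∂ν := by
    intro x
    have hac : P ≪ ν := Measure.smul_absolutelyContinuous
    have := φ.jensen (P := P) (((hb x).div_const k).mono_ac hac)
    rw [lintegral_smul_measure, lintegral_smul_measure, smul_eq_mul, smul_eq_mul] at this
    refine le_trans (le_of_eq ?_) this
    simp only [div_eq_mul_inv]
    rw [lintegral_mul_const'' _ (hb x), ENNReal.mul_inv (Or.inl hk0) (Or.inl hkt)]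
    ring_nf
  calc ∫⁻ x, φ.ext ((∫⁻ ω, b ω x ∂ν) / (k * ν univ)) ∂m
      ≤ ∫⁻ x, (ν univ)⁻¹ * ∫⁻ ω, φ.ext (b ω x / k) ∂ν ∂m := lintegral_mono h1
    _ = (ν univ)⁻¹ * ∫⁻ x, ∫⁻ ω, φ.ext (b ω x / k) ∂ν ∂m :=
        lintegral_const_mul' _ _ (by simpa using hν)
    _ ≤ (ν univ)⁻¹ * ∫⁻ ω, ∫⁻ x, φ.ext (b ω x / k) ∂m ∂ν := by
        gcongr
        exact swap k hk0 hkt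
    _ ≤ (ν univ)⁻¹ * ∫⁻ _, 1 ∂ν := by
        gcongr with ω
        exact lintegral_le_one_of_elux_lt ((hL ω).trans_lt hk)
    _ = 1 := by rw [lintegral_one]; exact ENNReal.inv_mul_cancel hν hν'

/-- The sum of the `u i` is the integral of the normalized functions `u i / k i` against the measure
with mass `k i` at `i`, where `k i` barely exceeds the norm of `u i`. Minkowski's inequality with `L
= 1` bounds it by `∑ k i`. -/
theorem elux_tsum_le [φ.Finite] {ι : Type*} [Countable ι] {u : ι → X → ℝ≥0∞}
    (hu : ∀ i, AEMeasurable (u i) m) :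
    elux φ m (fun x => ∑' i, u i x) ≤ ∑' i, elux φ m (u i) := by
  refine ENNReal.le_of_forall_pos_le_add fun ε hε hfin => ?_
  -- The summable perturbation keeps every `k i` positive, even when `u i` has norm zero.
  obtain ⟨ε', hε', hsum⟩ := ENNReal.exists_pos_sum_of_countable'
    (ε := ε) (by simpa using hε.ne') ι
  let _ : MeasurableSpace ι := ⊤
  have hlt : ∀ i, elux φ m (u i) < ∞ := fun i => (ENNReal.le_tsum i).trans_lt hfin
  have hε't : ∀ i, ε' i < ∞ := fun i =>
    ((ENNReal.le_tsum i).trans_lt hsum).trans ENNReal.coe_lt_top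
  let k : ι → ℝ≥0∞ := fun i => elux φ m (u i) + ε' i
  have hk : ∀ i, elux φ m (u i) < k i := fun i =>
    ENNReal.lt_add_right (hlt i).ne (hε' i).ne'
  have hk0 : ∀ i, k i ≠ 0 := fun i => (pos_of_gt (hk i)).ne'
  have hkt : ∀ i, k i ≠ ∞ := fun i => (ENNReal.add_lt_top.2 ⟨hlt i, hε't i⟩).ne
  have hksum : ∑' i, k i ≤ ∑' i, elux φ m (u i) + ε := by
    rw [ENNReal.tsum_add]
    gcongr
  let ν : Measure ι := Measure.count.withDensity k
  have hν : ∀ v : ι → ℝ≥0∞, ∫⁻ i, v i ∂ν = ∑' i, k i * v i := fun v => by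
    rw [lintegral_withDensity_eq_lintegral_mul _ measurable_from_top measurable_from_top,
      lintegral_count]
    rfl
  have hνu : ν univ = ∑' i, k i := by
    rw [← lintegral_one, hν]
    simp
  have : IsFiniteMeasure ν := ⟨by
    rw [hνu]
    exact hksum.trans_lt (ENNReal.add_lt_top.2 ⟨hfin, ENNReal.coe_lt_top⟩)⟩
  have key := elux_lintegral_le (φ := φ) (m := m) (ν := ν) (b := fun i x => u i x / k i) (L := 1)
    (fun x => measurable_from_top.aemeasurable) (fun i => ?_) (fun l _ _ => ?_)
  · simp only [hν] at key
    rw [hνu, mul_one] at key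
    refine le_trans (le_of_eq ?_) (key.trans hksum)
    congr 1
    ext x
    congr 1
    ext i
    rw [ENNReal.mul_div_cancel (hk0 i) (hkt i)]
  · have h := elux_const_mul (φ := φ) (m := m) (k i)⁻¹ (by simpa using hk0 i) (u i)
    simp only [div_eq_mul_inv, mul_comm (u i _)]
    rw [h]
    calc (k i)⁻¹ * elux φ m (u i) ≤ (k i)⁻¹ * k i := by gcongr; exact (hk i).le
      _ = 1 := ENNReal.inv_mul_cancel (hk0 i) (hkt i)
  · simp only [hν]
    have hmeas : ∀ i, AEMeasurable (fun x => k i * φ.ext (u i x / k i / l)) m := fun i =>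
      (φ.measurable_ext.comp_aemeasurable (((hu i).div_const _).div_const _)).const_mul _
    rw [lintegral_tsum hmeas]
    exact ENNReal.tsum_le_tsum fun i => (lintegral_const_mul' _ _ (hkt i)).le

theorem elux_add_le [φ.Finite] {u v : X → ℝ≥0∞} (hu : AEMeasurable u m) (hv : AEMeasurable v m) :
    elux φ m (fun x => u x + v x) ≤ elux φ m u + elux φ m v := by
  have := elux_tsum_le (φ := φ) (m := m) (u := fun b : Bool => cond b u v)
    (fun b => by cases b <;> assumption)
  simp only [tsum_bool, cond_true, cond_false] at this
  rw [add_comm (elux φ m u)]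
  simpa only [add_comm] using this

/-- The sum of infinitely many copies of `u` still has norm zero, so it is finite almost everywhere,
which forces `u` to vanish there. -/
theorem ae_eq_zero_of_elux_eq_zero [φ.Finite] {u : X → ℝ≥0∞} (hu : AEMeasurable u m)
    (h : elux φ m u = 0) : u =ᵐ[m] 0 := by
  have h1 := elux_tsum_le (φ := φ) (m := m) (u := fun _ : ℕ => u) (fun _ => hu)
  simp only [h, tsum_zero] at h1
  filter_upwards [ae_lt_top_of_elux_lt_top (AEMeasurable.tsum fun _ => hu)
    (h1.trans_lt ENNReal.zero_lt_top)] with x hx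
  by_contra hcon
  exact hx.ne (ENNReal.tsum_const_eq_top_of_ne_zero hcon)

theorem luxemburgNorm_eq_elux (f : X → ℂ) :
    luxemburgNorm φ m f = elux φ m (fun x => ‖f x‖ₑ) := by
  have e : ∀ k : ℝ, 0 < k → modular φ m (fun x => f x / (k : ℂ)) =
      ∫⁻ x, φ.ext (‖f x‖ₑ / ENNReal.ofReal k) ∂m := by
    intro k hk
    refine lintegral_congr fun x => ?_
    rw [← φ.ext_enorm, ← ofReal_norm, ← ofReal_norm, norm_div, Complex.norm_real,
      Real.norm_of_nonneg hk.le, ENNReal.ofReal_div_of_pos hk]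
  refine le_antisymm ?_ ?_
  · refine le_of_forall_gt fun l hl => ?_
    obtain ⟨k, hk, hkl⟩ := exists_between hl
    refine lt_of_le_of_lt (sInf_le ?_) hkl
    have hkt := (hkl.trans_le le_top).ne
    refine ⟨k.toReal, ⟨ENNReal.toReal_pos (pos_of_gt hk).ne' hkt, ?_⟩, ENNReal.ofReal_toReal hkt⟩
    rw [e _ (ENNReal.toReal_pos (pos_of_gt hk).ne' hkt), ENNReal.ofReal_toReal hkt]
    exact lintegral_le_one_of_elux_lt hk
  · refine le_sInf ?_
    rintro _ ⟨k, ⟨hk, h⟩, rfl⟩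
    rw [e k hk] at h
    exact elux_le (by simpa using hk) h

end Elux

/-! ### The Orlicz space as a Banach space -/

section NormedSpace

variable {X : Type*} [MeasurableSpace X] {φ : YoungFunction} {m : Measure X}

theorem mem_orliczSpace_iff (f : X →ₘ[m] ℂ) :
    f ∈ orliczSpace φ m ↔ elux φ m (fun x => ‖f x‖ₑ) < ∞ := by
  have e : ∀ a : ℝ, 0 < a → modular φ m (fun x => (a : ℂ) * f x) =
      ∫⁻ x, φ.ext (‖f x‖ₑ / ENNReal.ofReal a⁻¹) ∂m := by
    intro a ha
    refine lintegral_congr fun x => ?_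
    rw [← φ.ext_enorm, ← ofReal_norm, ← ofReal_norm, norm_mul, Complex.norm_real,
      Real.norm_of_nonneg ha.le, ← ENNReal.ofReal_div_of_pos (inv_pos.2 ha), div_inv_eq_mul,
      mul_comm]
  constructor
  · rintro ⟨a, ha, h⟩
    rw [e a ha] at h
    set M := ∫⁻ x, φ.ext (‖f x‖ₑ / ENNReal.ofReal a⁻¹) ∂m
    have ha' : ENNReal.ofReal a⁻¹ ≠ 0 := by simpa using ha
    -- By convexity and `φ 0 = 0`, shrinking the argument by `(M + 1)⁻¹` shrinks the modular `M` by
    -- at least that factor. The `+ 1` makes the factor at most one, as convexity requires.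
    refine lt_of_le_of_lt (elux_le (k := ENNReal.ofReal a⁻¹ * (M + 1)) (mul_ne_zero ha' (by simp))
      ?_) (ENNReal.mul_lt_top ENNReal.ofReal_lt_top (by simpa using h))
    have hM1 : (M + 1)⁻¹ ≤ 1 := by simp
    calc ∫⁻ x, φ.ext (‖f x‖ₑ / (ENNReal.ofReal a⁻¹ * (M + 1))) ∂m
        = ∫⁻ x, φ.ext ((M + 1)⁻¹ * (‖f x‖ₑ / ENNReal.ofReal a⁻¹)) ∂m := by
          refine lintegral_congr fun x => ?_
          simp only [div_eq_mul_inv]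
          rw [ENNReal.mul_inv (Or.inl ha') (Or.inl ENNReal.ofReal_ne_top)]
          ring_nf
      _ ≤ ∫⁻ x, (M + 1)⁻¹ * φ.ext (‖f x‖ₑ / ENNReal.ofReal a⁻¹) ∂m :=
          lintegral_mono fun x => φ.ext_mul_le hM1
      _ = (M + 1)⁻¹ * M := lintegral_const_mul' _ _ (by simp)
      _ ≤ (M + 1)⁻¹ * (M + 1) := by gcongr; simp
      _ ≤ 1 := ENNReal.inv_mul_le_one _
  · intro h
    obtain ⟨k, hk, hkt⟩ := exists_between h
    have hk0 : 0 < k.toReal := ENNReal.toReal_pos (pos_of_gt hk).ne' hkt.ne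
    refine ⟨k.toReal⁻¹, inv_pos.2 hk0, ?_⟩
    rw [e _ (inv_pos.2 hk0), inv_inv, ENNReal.ofReal_toReal hkt.ne]
    exact (lintegral_le_one_of_elux_lt hk).trans_lt ENNReal.one_lt_top

theorem elux_coe_lt_top (f : orliczSpace φ m) : elux φ m (fun x => ‖f.1 x‖ₑ) < ∞ :=
  (mem_orliczSpace_iff f.1).1 f.2

theorem aemeasurable_enorm_coe (f : X →ₘ[m] ℂ) : AEMeasurable (fun x => ‖f x‖ₑ) m :=
  f.aestronglyMeasurable.enorm

noncomputable instance : Norm (orliczSpace φ m) := ⟨fun f => (luxemburgNorm φ m f.1).toReal⟩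

theorem ofReal_norm_orlicz (f : orliczSpace φ m) :
    ENNReal.ofReal ‖f‖ = elux φ m (fun x => ‖f.1 x‖ₑ) := by
  change ENNReal.ofReal (luxemburgNorm φ m f.1).toReal = _
  rw [luxemburgNorm_eq_elux, ENNReal.ofReal_toReal (elux_coe_lt_top f).ne]

theorem norm_orlicz_eq (f : orliczSpace φ m) : ‖f‖ = (elux φ m (fun x => ‖f.1 x‖ₑ)).toReal := by
  rw [← luxemburgNorm_eq_elux]
  rfl

theorem elux_smul (c : ℂ) (f : X →ₘ[m] ℂ) :
    elux φ m (fun x => ‖(c • f) x‖ₑ) = ‖c‖ₑ * elux φ m (fun x => ‖f x‖ₑ) := by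
  rw [← elux_const_mul _ enorm_ne_top]
  refine elux_congr_ae ?_
  filter_upwards [AEEqFun.coeFn_smul c f] with x hx
  rw [hx, Pi.smul_apply, smul_eq_mul, enorm_mul]

/-- The class in `L^φ` of a function of finite Luxemburg norm. -/
noncomputable def orliczMk (f : X → ℂ) (hf : AEStronglyMeasurable f m)
    (h : elux φ m (fun x => ‖f x‖ₑ) < ∞) : orliczSpace φ m :=
  ⟨AEEqFun.mk f hf, (mem_orliczSpace_iff _).2 (by
    rwa [elux_congr_ae (v := fun x => ‖f x‖ₑ)]
    filter_upwards [AEEqFun.coeFn_mk f hf] with x hx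
    rw [hx])⟩

theorem orliczMk_coe {f : X → ℂ} (hf : AEStronglyMeasurable f m)
    (h : elux φ m (fun x => ‖f x‖ₑ) < ∞) : (orliczMk f hf h).1 =ᵐ[m] f :=
  AEEqFun.coeFn_mk f hf

theorem ofReal_norm_sub_orlicz {f g : orliczSpace φ m} {f' g' : X → ℂ} (hf : f.1 =ᵐ[m] f')
    (hg : g.1 =ᵐ[m] g') : ENNReal.ofReal ‖f - g‖ = elux φ m (fun x => ‖f' x - g' x‖ₑ) := by
  rw [ofReal_norm_orlicz]
  refine elux_congr_ae ?_
  filter_upwards [AEEqFun.coeFn_sub f.1 g.1, hf, hg] with x hx h1 h2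
  rw [Submodule.coe_sub, hx, Pi.sub_apply, h1, h2]

theorem coeFn_finset_sum {ι : Type*} (u : ι → orliczSpace φ m) (s : Finset ι) :
    (∑ i ∈ s, u i).1 =ᵐ[m] fun x => ∑ i ∈ s, (u i).1 x := by
  classical
  induction s using Finset.induction_on with
  | empty =>
    filter_upwards [AEEqFun.coeFn_zero (μ := m) (β := ℂ)] with x hx
    simp [hx]
  | insert i s hi ih =>
    rw [Finset.sum_insert hi]
    filter_upwards [ih, AEEqFun.coeFn_add (u i).1 (∑ i ∈ s, u i).1] with x hx h2
    rw [Submodule.coe_add, h2, Pi.add_apply, hx, Finset.sum_insert hi]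

variable [φ.Finite]

theorem elux_enorm_add_le {f g : X → ℂ} (hf : AEStronglyMeasurable f m)
    (hg : AEStronglyMeasurable g m) : elux φ m (fun x => ‖f x + g x‖ₑ) ≤
      elux φ m (fun x => ‖f x‖ₑ) + elux φ m (fun x => ‖g x‖ₑ) :=
  (elux_mono fun _ => enorm_add_le _ _).trans (elux_add_le hf.enorm hg.enorm)

theorem orliczSpace_core : NormedSpace.Core ℂ (orliczSpace φ m) where
  norm_nonneg f := ENNReal.toReal_nonneg
  norm_smul c f := by
    rw [norm_orlicz_eq, norm_orlicz_eq, Submodule.coe_smul, elux_smul, ENNReal.toReal_mul,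
      toReal_enorm]
  norm_triangle f g := by
    rw [norm_orlicz_eq, norm_orlicz_eq, norm_orlicz_eq,
      ← ENNReal.toReal_add (elux_coe_lt_top f).ne (elux_coe_lt_top g).ne]
    refine ENNReal.toReal_mono
      (ENNReal.add_lt_top.2 ⟨elux_coe_lt_top f, elux_coe_lt_top g⟩).ne ?_
    refine le_trans (elux_mono_ae ?_) (elux_enorm_add_le f.1.aestronglyMeasurable
      g.1.aestronglyMeasurable)
    filter_upwards [AEEqFun.coeFn_add f.1 g.1] with x hx
    rw [Submodule.coe_add, hx, Pi.add_apply]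
  norm_eq_zero_iff f := by
    rw [norm_orlicz_eq, ENNReal.toReal_eq_zero_iff, or_iff_left (elux_coe_lt_top f).ne]
    constructor
    · intro h
      refine Subtype.ext (AEEqFun.ext ?_)
      filter_upwards [ae_eq_zero_of_elux_eq_zero (aemeasurable_enorm_coe f.1) h,
        AEEqFun.coeFn_zero (μ := m) (β := ℂ)] with x hx h0
      rw [Submodule.coe_zero, h0]
      simpa using hx
    · rintro rfl
      rw [← elux_zero (φ := φ) (m := m)]
      refine elux_congr_ae ?_
      filter_upwards [AEEqFun.coeFn_zero (μ := m) (β := ℂ)] with x hx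
      rw [Submodule.coe_zero, hx]
      simp

noncomputable instance : NormedAddCommGroup (orliczSpace φ m) :=
  NormedAddCommGroup.ofCore orliczSpace_core

noncomputable instance : NormedSpace ℂ (orliczSpace φ m) :=
  NormedSpace.ofCore orliczSpace_core

theorem ae_tsum_enorm_lt_top {v : ℕ → X → ℂ} (hv : ∀ n, AEStronglyMeasurable (v n) m)
    (h : ∑' n, elux φ m (fun x => ‖v n x‖ₑ) ≠ ∞) : ∀ᵐ x ∂m, ∑' n, ‖v n x‖ₑ < ∞ :=
  ae_lt_top_of_elux_lt_top (φ := φ) (AEMeasurable.tsum fun n => (hv n).enorm)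
    ((elux_tsum_le fun n => (hv n).enorm).trans_lt (lt_top_iff_ne_top.2 h))

theorem ae_tendsto_of_tsum_elux_ne_top {v : ℕ → X → ℂ} {w : X → ℂ}
    (hv : ∀ n, AEStronglyMeasurable (v n) m) (hw : AEStronglyMeasurable w m)
    (h : ∑' n, elux φ m (fun x => ‖v n x - w x‖ₑ) ≠ ∞) :
    ∀ᵐ x ∂m, Tendsto (fun n => v n x) atTop (𝓝 (w x)) := by
  filter_upwards [ae_tsum_enorm_lt_top (v := fun n x => v n x - w x)
    (fun n => (hv n).sub hw) h] with x hx
  rw [tendsto_iff_edist_tendsto_0]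
  simpa only [edist_eq_enorm_sub] using ENNReal.tendsto_atTop_zero_of_tsum_ne_top hx.ne

/-- Riesz–Fischer: an absolutely convergent series converges pointwise almost everywhere by the
countable triangle inequality, which also bounds the remainder of the pointwise sum by the tail of
the norms. -/
instance : CompleteSpace (orliczSpace φ m) := by
  refine NormedAddCommGroup.completeSpace_of_summable_imp_tendsto fun u hu => ?_
  let v : ℕ → X → ℂ := fun n x => (u n).1 x
  have hv : ∀ n, AEStronglyMeasurable (v n) m := fun n => (u n).1.aestronglyMeasurable
  have hsum : ∑' n, elux φ m (fun x => ‖v n x‖ₑ) ≠ ∞ := by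
    simp only [v, ← ofReal_norm_orlicz]
    exact hu.tsum_ofReal_ne_top
  have hae : ∀ᵐ x ∂m, Summable fun n => v n x := by
    filter_upwards [ae_tsum_enorm_lt_top hv hsum] with x hx
    refine Summable.of_norm ?_
    have := ENNReal.summable_toReal hx.ne
    simpa using this
  have hSm : AEStronglyMeasurable (fun x => ∑' n, v n x) m := by
    refine aestronglyMeasurable_of_tendsto_ae atTop (f := fun n x => ∑ i ∈ Finset.range n, v i x)
      (fun n => Finset.aestronglyMeasurable_fun_sum _ fun i _ => hv i) ?_
    filter_upwards [hae] with x hx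
    exact hx.hasSum.tendsto_sum_nat
  have hS : elux φ m (fun x => ‖∑' n, v n x‖ₑ) < ∞ := by
    refine lt_of_le_of_lt (elux_mono fun x => enorm_tsum_le_tsum_enorm) ?_
    exact (elux_tsum_le fun n => (hv n).enorm).trans_lt (lt_top_iff_ne_top.2 hsum)
  refine ⟨orliczMk _ hSm hS, ?_⟩
  rw [tendsto_iff_norm_sub_tendsto_zero]
  have h0 : Tendsto (fun n => ENNReal.ofReal ‖∑ i ∈ Finset.range n, u i - orliczMk _ hSm hS‖)
      atTop (𝓝 0) := by
    refine tendsto_of_tendsto_of_tendsto_of_le_of_le tendsto_const_nhds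
      (ENNReal.tendsto_sum_nat_add _ hsum) (fun _ => zero_le) fun n => ?_
    dsimp only
    rw [ofReal_norm_sub_orlicz (coeFn_finset_sum u _) (orliczMk_coe hSm hS)]
    refine le_trans (elux_mono_ae ?_) (elux_tsum_le fun i => (hv (i + n)).enorm)
    filter_upwards [hae] with x hx
    rw [← hx.sum_add_tsum_nat_add n, sub_add_cancel_left, enorm_neg]
    exact enorm_tsum_le_tsum_enorm
  have := (ENNReal.tendsto_toReal ENNReal.zero_ne_top).comp h0
  simpa [Function.comp_def] using this

end NormedSpace

/-! ### Density of `C_c` under the `Δ₂`-condition -/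

section Density

variable {X : Type*} [MeasurableSpace X] {φ : YoungFunction} {m : Measure X}

theorem DeltaTwo.lintegral_ext_two_mul_lt_top [φ.Finite] (hΔ : DeltaTwo φ m) {v : X → ℝ≥0∞}
    (h : ∫⁻ x, φ.ext (v x) ∂m < ∞) : ∫⁻ x, φ.ext (2 * v x) ∂m < ∞ := by
  rcases eq_or_ne (m univ) ∞ with hm | hm
  · obtain ⟨C, hC, hφ⟩ := hΔ.2 hm
    have h1 : ∀ t, φ.ext (2 * t) ≤ C * φ.ext t := by
      intro t
      by_cases ht : t = ∞
      · simp [ht, ENNReal.mul_top, hC.ne']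
      rw [φ.ext_of_ne_top ht, φ.ext_of_ne_top (by simp [ENNReal.mul_eq_top, ht]),
        ENNReal.toReal_mul]
      exact hφ _ ENNReal.toReal_nonneg
    refine (lintegral_mono fun x => h1 (v x)).trans_lt ?_
    rw [lintegral_const_mul' _ _ ENNReal.coe_ne_top]
    exact ENNReal.mul_lt_top ENNReal.coe_lt_top h
  · obtain ⟨C, hC, x₀, hx₀, hφ⟩ := hΔ.1 (lt_top_iff_ne_top.2 hm)
    -- Below `x₀` doubling is controlled only by the constant `φ (2 x₀)`, which is integrable since
    -- `m` is finite.
    have h1 : ∀ t, φ.ext (2 * t) ≤ C * φ.ext t + φ.toFun (2 * x₀) := by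
      intro t
      by_cases ht : t = ∞
      · simp [ht, ENNReal.mul_top, hC.ne']
      rw [φ.ext_of_ne_top ht, φ.ext_of_ne_top (by simp [ENNReal.mul_eq_top, ht]),
        ENNReal.toReal_mul]
      rcases le_total x₀ t.toReal with h2 | h2
      · exact (hφ _ h2).trans le_self_add
      · refine le_trans (φ.mono (by positivity) ?_) le_add_self
        simpa using h2
    refine (lintegral_mono fun x => h1 (v x)).trans_lt ?_
    rw [lintegral_add_right _ measurable_const, lintegral_const_mul' _ _ ENNReal.coe_ne_top,
      lintegral_const]
    exact ENNReal.add_lt_top.2 ⟨ENNReal.mul_lt_top ENNReal.coe_lt_top h,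
      ENNReal.mul_lt_top (lt_top_iff_ne_top.2 (YoungFunction.Finite.ne_top _))
        (lt_top_iff_ne_top.2 hm)⟩

/-- Iterating the doubling gives all factors `2 ^ n`. That every multiple of `u` has finite modular
is what makes dominated convergence available in `L^φ`. -/
theorem DeltaTwo.lintegral_ext_mul_lt_top [φ.Finite] (hΔ : DeltaTwo φ m) {u : X → ℝ≥0∞}
    (h : elux φ m u < ∞) {t : ℝ≥0∞} (ht : t ≠ ∞) : ∫⁻ x, φ.ext (t * u x) ∂m < ∞ := by
  obtain ⟨k, hk, hkt⟩ := exists_between h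
  have h0 : ∀ n : ℕ, ∫⁻ x, φ.ext (2 ^ n * (u x / k)) ∂m < ∞ := by
    intro n
    induction n with
    | zero =>
      simpa using (lintegral_le_one_of_elux_lt hk).trans_lt ENNReal.one_lt_top
    | succ n ih =>
      have := hΔ.lintegral_ext_two_mul_lt_top ih
      simpa only [← mul_assoc, ← pow_succ'] using this
  have hk0 : k ≠ 0 := (pos_of_gt hk).ne'
  obtain ⟨n, hn⟩ := ENNReal.exists_nat_gt (ENNReal.mul_ne_top ht hkt.ne)
  refine (lintegral_mono fun x => φ.ext_mono ?_).trans_lt (h0 n)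
  have h2 : t * k ≤ 2 ^ n := hn.le.trans (by exact_mod_cast n.lt_two_pow_self.le)
  calc t * u x = t * k * (u x / k) := by
        rw [mul_assoc, ENNReal.mul_div_cancel hk0 hkt.ne]
    _ ≤ _ := by gcongr

theorem exists_simpleFunc_elux_sub_le [φ.Finite] (hΔ : DeltaTwo φ m) {g : X → ℂ}
    (hg : Measurable g) (h : elux φ m (fun x => ‖g x‖ₑ) < ∞) {ε : ℝ≥0∞} (hε : ε ≠ 0) :
    ∃ s : SimpleFunc X ℂ, m (Function.support s) < ∞ ∧
      elux φ m (fun x => ‖s x - g x‖ₑ) ≤ ε := by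
  wlog hεt : ε ≠ ∞ generalizing ε
  · obtain ⟨s, hs, h1⟩ := this one_ne_zero ENNReal.one_ne_top
    exact ⟨s, hs, h1.trans (by simp at hεt; simp [hεt])⟩
  let s : ℕ → SimpleFunc X ℂ := fun n => SimpleFunc.approxOn g hg univ 0 (mem_univ _) n
  have hs : ∀ n x, ‖s n x‖ₑ ≤ 2 * ‖g x‖ₑ := by
    intro n x
    have := SimpleFunc.norm_approxOn_zero_le hg (mem_univ (0 : ℂ)) x n
    rw [← ofReal_norm, ← ofReal_norm, ← ENNReal.ofReal_ofNat, ← ENNReal.ofReal_mul (by norm_num)]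
    exact ENNReal.ofReal_le_ofReal (by simp only [s]; linarith)
  have hlim : ∀ x, Tendsto (fun n => s n x) atTop (𝓝 (g x)) := fun x =>
    SimpleFunc.tendsto_approxOn hg (mem_univ _) (by simp)
  have hsupp : ∀ n, m (Function.support (s n)) < ∞ := by
    intro n
    refine SimpleFunc.measure_support_lt_top _ fun c hc => ?_
    -- Chebyshev's inequality: where `s n = c`, the bound `|s n| ≤ 2 |g|` makes a fixed multiple of
    -- `|g|` at least `x`, and there its `φ` exceeds one.
    obtain ⟨x, hx, hx1⟩ := φ.exists_lt_ext ENNReal.one_lt_top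
    have hc' : ‖c‖ₑ ≠ 0 := by simpa using hc
    have h1 : ∫⁻ y, φ.ext (ENNReal.ofReal x / ‖c‖ₑ * 2 * ‖g y‖ₑ) ∂m < ∞ :=
      hΔ.lintegral_ext_mul_lt_top h
        (ENNReal.mul_ne_top (ENNReal.div_ne_top ENNReal.ofReal_ne_top hc') (by simp))
    refine lt_of_le_of_lt ?_ h1
    rw [← lintegral_indicator_one ((s n).measurableSet_fiber c)]
    refine lintegral_mono fun y => ?_
    by_cases hy : y ∈ s n ⁻¹' {c}
    · rw [indicator_of_mem hy, Pi.one_apply]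
      refine hx1.le.trans ?_
      rw [← φ.ext_ofReal hx.le]
      refine φ.ext_mono ?_
      calc ENNReal.ofReal x = ENNReal.ofReal x / ‖c‖ₑ * ‖s n y‖ₑ := by
            rw [show s n y = c from hy, ENNReal.div_mul_cancel hc' enorm_ne_top]
        _ ≤ ENNReal.ofReal x / ‖c‖ₑ * (2 * ‖g y‖ₑ) := by gcongr; exact hs n y
        _ = _ := by ring
    · simp [indicator_of_notMem hy]
  -- The majorant comes from `|s n - g| ≤ 3 |g|`.
  have key : Tendsto (fun n => ∫⁻ x, φ.ext (‖s n x - g x‖ₑ / ε) ∂m) atTop (𝓝 (∫⁻ _, 0 ∂m)) := by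
    refine tendsto_lintegral_of_dominated_convergence (fun x => φ.ext (3 / ε * ‖g x‖ₑ))
      (fun n => φ.measurable_ext.comp (((s n).measurable.sub hg).enorm.div_const _))
      (fun n => Eventually.of_forall fun x => φ.ext_mono ?_)
      (hΔ.lintegral_ext_mul_lt_top h (ENNReal.div_ne_top (by simp) hε)).ne
      (Eventually.of_forall fun x => ?_)
    · rw [ENNReal.div_eq_inv_mul, ENNReal.div_eq_inv_mul, mul_assoc]
      gcongr
      calc ‖s n x - g x‖ₑ ≤ ‖s n x‖ₑ + ‖g x‖ₑ := enorm_sub_le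
        _ ≤ 2 * ‖g x‖ₑ + ‖g x‖ₑ := by gcongr; exact hs n x
        _ = 3 * ‖g x‖ₑ := by ring
    · have h1 : Tendsto (fun n => ‖s n x - g x‖ₑ / ε) atTop (𝓝 0) := by
        have h2 := tendsto_iff_edist_tendsto_0.1 (hlim x)
        simp only [edist_eq_enorm_sub] at h2
        have := ENNReal.Tendsto.div_const h2 (Or.inr hε)
        simpa using this
      have := (φ.continuous_ext.tendsto 0).comp h1
      simpa [Function.comp_def] using this
  rw [lintegral_zero] at key
  obtain ⟨n, hn⟩ := (key.eventually (ge_mem_nhds zero_lt_one)).exists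
  exact ⟨s n, hsupp n, elux_le hε hn⟩

variable [TopologicalSpace X] [BorelSpace X] [T2Space X] [LocallyCompactSpace X] [m.Regular]

/-- Take a Urysohn function between `K ⊆ A ⊆ U`. The error is at most `|c|` and lives on `(A \ K) ∪
(U \ A)`, whose measure is made at most `1 / (D + 1)`, so the modular of the error divided by `ε` is
at most one. -/
theorem exists_compactlySupported_elux_indicator_sub_le [φ.Finite] {A : Set X}
    (hA : MeasurableSet A) (hmA : m A ≠ ∞) (c : ℂ) {ε : ℝ≥0∞} (hε : ε ≠ 0) :
    ∃ k : C_c(X, ℂ), elux φ m (fun x => ‖k x - A.indicator (fun _ => c) x‖ₑ) ≤ ε := by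
  set D := φ.ext (‖c‖ₑ / ε) with hD
  have hDt : D ≠ ∞ := φ.ext_ne_top (ENNReal.div_ne_top enorm_ne_top hε)
  have hδ : (D + 1)⁻¹ / 2 ≠ 0 := by
    simp [ENNReal.div_eq_zero_iff, hDt]
  obtain ⟨K, hKA, hK, hmK⟩ := hA.exists_isCompact_sdiff_lt hmA hδ
  obtain ⟨U, hAU, hU, -, hmU⟩ := hA.exists_isOpen_sdiff_lt hmA hδ
  obtain ⟨ψ, hψK, hψc, hψU, hψ⟩ := exists_continuousMap_one_of_isCompact_subset_isOpen hK hU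
    (hKA.trans hAU)
  let k : C_c(X, ℂ) :=
    ⟨⟨fun x => (ψ x : ℂ) * c, by fun_prop⟩, by
      refine HasCompactSupport.mul_right (f := fun x => (ψ x : ℂ)) ?_
      exact HasCompactSupport.comp_left (g := fun x : ℝ => (x : ℂ)) hψc (by simp)⟩
  refine ⟨k, elux_le hε ?_⟩
  have hE : m (A \ K ∪ U \ A) ≤ (D + 1)⁻¹ := by
    refine (measure_union_le _ _).trans ?_
    calc m (A \ K) + m (U \ A) ≤ (D + 1)⁻¹ / 2 + (D + 1)⁻¹ / 2 := by gcongr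
      _ = _ := ENNReal.add_halves _
  have hb : ∀ x, φ.ext (‖k x - A.indicator (fun _ => c) x‖ₑ / ε) ≤
      (A \ K ∪ U \ A).indicator (fun _ => D) x := by
    intro x
    have hk : k x = (ψ x : ℂ) * c := rfl
    by_cases hx : x ∈ A \ K ∪ U \ A
    · rw [indicator_of_mem hx, hD]
      refine φ.ext_mono ?_
      gcongr
      rw [← ofReal_norm, ← ofReal_norm]
      refine ENNReal.ofReal_le_ofReal ?_
      obtain ⟨h0, h1⟩ := hψ x
      by_cases hxA : x ∈ A
      · rw [indicator_of_mem hxA, hk, ← sub_one_mul, norm_mul]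
        refine mul_le_of_le_one_left (norm_nonneg _) ?_
        rw [← Complex.ofReal_one, ← Complex.ofReal_sub, Complex.norm_real, Real.norm_eq_abs,
          abs_le]
        constructor <;> linarith
      · rw [indicator_of_notMem hxA, hk, sub_zero, norm_mul, Complex.norm_real,
          Real.norm_of_nonneg h0]
        exact mul_le_of_le_one_left (norm_nonneg _) h1
    · rw [indicator_of_notMem hx]
      have : k x - A.indicator (fun _ => c) x = 0 := by
        by_cases hxA : x ∈ A
        · have hxK : x ∈ K := by
            by_contra hcon
            exact hx (Or.inl ⟨hxA, hcon⟩)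
          rw [indicator_of_mem hxA, hk, hψK hxK]
          simp
        · have hxU : x ∉ U := fun hcon => hx (Or.inr ⟨hcon, hxA⟩)
          rw [indicator_of_notMem hxA, hk, image_eq_zero_of_notMem_tsupport fun h => hxU (hψU h)]
          simp
      simp [this]
  calc ∫⁻ x, φ.ext (‖k x - A.indicator (fun _ => c) x‖ₑ / ε) ∂m
      ≤ ∫⁻ x, (A \ K ∪ U \ A).indicator (fun _ => D) x ∂m := lintegral_mono hb
    _ ≤ D * m (A \ K ∪ U \ A) := lintegral_indicator_const_le _ _
    _ ≤ (D + 1) * (D + 1)⁻¹ := by gcongr; simp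
    _ ≤ 1 := ENNReal.mul_inv_le_one _

theorem exists_compactlySupported_elux_simpleFunc_sub_le [φ.Finite] (s : SimpleFunc X ℂ)
    (hs : m (Function.support s) < ∞) {ε : ℝ≥0∞} (hε : ε ≠ 0) :
    ∃ k : C_c(X, ℂ), elux φ m (fun x => ‖k x - s x‖ₑ) ≤ ε := by
  induction s using SimpleFunc.induction generalizing ε with
  | const c hA =>
    rename_i A
    by_cases hc : c = 0
    · refine ⟨0, ?_⟩
      simp [hc]
    · have hmA : m A ≠ ∞ := by
        refine ne_top_of_le_ne_top hs.ne (measure_mono fun x hx => ?_)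
        simp [hx, hc]
      obtain ⟨k, hk⟩ := exists_compactlySupported_elux_indicator_sub_le (φ := φ) hA hmA c hε
      refine ⟨k, ?_⟩
      simpa [indicator, piecewise] using hk
  | add hd hf hg =>
    rename_i f g
    have h2 : ε / 2 ≠ 0 := by simp [hε]
    have hsf : Function.support f ⊆ Function.support (f + g) := fun x hx => by
      have : g x = 0 := Function.notMem_support.1 (disjoint_left.1 hd hx)
      simpa [this] using hx
    have hsg : Function.support g ⊆ Function.support (f + g) := fun x hx => by
      have : f x = 0 := Function.notMem_support.1 (disjoint_right.1 hd hx)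
      simpa [this] using hx
    obtain ⟨k, hk⟩ := hf ((measure_mono hsf).trans_lt hs) h2
    obtain ⟨l, hl⟩ := hg ((measure_mono hsg).trans_lt hs) h2
    refine ⟨k + l, ?_⟩
    calc elux φ m (fun x => ‖(k + l) x - (f + g) x‖ₑ)
        = elux φ m (fun x => ‖(k x - f x) + (l x - g x)‖ₑ) := by
          congr 1
          ext x
          simp only [CompactlySupportedContinuousMap.coe_add, Pi.add_apply, SimpleFunc.coe_add]
          ring_nf
      _ ≤ _ := elux_enorm_add_le
          (k.continuous.measurable.sub f.measurable).aestronglyMeasurable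
          (l.continuous.measurable.sub g.measurable).aestronglyMeasurable
      _ ≤ ε / 2 + ε / 2 := by gcongr
      _ = ε := ENNReal.add_halves ε

/-- Under the `Δ₂`-condition the functions in `C_c(X)` are dense in `L^φ`. -/
theorem exists_compactlySupported_elux_sub_le [φ.Finite] (hΔ : DeltaTwo φ m) {g : X → ℂ}
    (hg : AEStronglyMeasurable g m) (h : elux φ m (fun x => ‖g x‖ₑ) < ∞) {ε : ℝ≥0∞}
    (hε : ε ≠ 0) : ∃ k : C_c(X, ℂ), elux φ m (fun x => ‖k x - g x‖ₑ) ≤ ε := by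
  wlog hgm : Measurable g generalizing g
  · obtain ⟨k, hk⟩ := this (g := hg.mk g) hg.stronglyMeasurable_mk.aestronglyMeasurable
      (lt_of_le_of_lt (elux_mono_ae (hg.ae_eq_mk.mono fun x hx => by simp [hx])) h)
      hg.stronglyMeasurable_mk.measurable
    exact ⟨k, (elux_mono_ae (hg.ae_eq_mk.mono fun x hx => by simp [hx])).trans hk⟩
  have h2 : ε / 2 ≠ 0 := by simp [hε]
  obtain ⟨s, hs, h1⟩ := exists_simpleFunc_elux_sub_le hΔ hgm h h2
  obtain ⟨k, hk⟩ := exists_compactlySupported_elux_simpleFunc_sub_le (φ := φ) s hs h2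
  refine ⟨k, ?_⟩
  calc elux φ m (fun x => ‖k x - g x‖ₑ)
      = elux φ m (fun x => ‖(k x - s x) + (s x - g x)‖ₑ) := by simp
    _ ≤ _ := elux_enorm_add_le (k.continuous.measurable.sub s.measurable).aestronglyMeasurable
        (s.measurable.sub hgm).aestronglyMeasurable
    _ ≤ ε / 2 + ε / 2 := by gcongr
    _ = ε := ENNReal.add_halves ε

end Density

/-! ### `L¹` as an Orlicz space -/

section AbsYoung

/-- The Young function `|x|`, whose Orlicz space is `L¹`. -/
noncomputable def absYoung : YoungFunction where
  toFun x := ‖x‖ₑ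
  convex := by
    refine ⟨convex_univ, fun x _ y _ a b _ _ _ => ?_⟩
    refine (enorm_add_le _ _).trans (le_of_eq ?_)
    simp [NNReal.smul_def, ENNReal.smul_def, enorm_mul]
  even x := enorm_neg x
  leftCont x _ := continuous_enorm.continuousWithinAt
  map_zero := enorm_zero
  tendsto_top := by
    refine (ENNReal.tendsto_ofReal_atTop.comp tendsto_norm_atTop_atTop).congr fun x => ?_
    exact ofReal_norm x

instance : absYoung.Finite := ⟨fun _ => enorm_ne_top⟩

theorem deltaTwo_absYoung {X : Type*} [MeasurableSpace X] (m : Measure X) :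
    DeltaTwo absYoung m := by
  have h : ∀ x : ℝ, absYoung.toFun (2 * x) ≤ (2 : ℝ≥0) * absYoung.toFun x := fun x => by
    simp only [absYoung, enorm_mul]
    gcongr
    rw [← ofReal_norm]
    simp
  exact ⟨fun _ => ⟨2, by simp, 1, one_pos, fun x _ => h x⟩, fun _ => ⟨2, by simp, fun x _ => h x⟩⟩

/-- This lets density and the choice of fast sequences be proved once for `L¹` and `L^φ`. -/
theorem elux_absYoung {X : Type*} [MeasurableSpace X] (m : Measure X) (u : X → ℝ≥0∞) :
    elux absYoung m u = ∫⁻ x, u x ∂m := by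
  have hext : ∀ t, absYoung.ext t = t := by
    intro t
    by_cases ht : t = ∞
    · simp [ht]
    · rw [absYoung.ext_of_ne_top ht]
      simp only [absYoung]
      rw [← ofReal_norm, Real.norm_of_nonneg ENNReal.toReal_nonneg, ENNReal.ofReal_toReal ht]
  have hint : ∀ k : ℝ≥0∞, k ≠ 0 → ∫⁻ x, absYoung.ext (u x / k) ∂m = (∫⁻ x, u x ∂m) / k := by
    intro k hk
    simp only [hext, div_eq_mul_inv]
    exact lintegral_mul_const' _ _ (by simpa using hk)
  refine le_antisymm ?_ ?_
  · refine le_of_forall_gt fun l hl => ?_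
    obtain ⟨k, hk, hkl⟩ := exists_between hl
    have hk0 : k ≠ 0 := (pos_of_gt hk).ne'
    refine lt_of_le_of_lt (elux_le hk0 ?_) hkl
    rw [hint k hk0]
    exact ENNReal.div_le_of_le_mul (by simpa using hk.le)
  · refine le_of_forall_gt fun l hl => ?_
    obtain ⟨k, hk, hkl⟩ := exists_between hl
    have hk0 : k ≠ 0 := (pos_of_gt hk).ne'
    have := lintegral_le_one_of_elux_lt hk
    rw [hint k hk0, ENNReal.div_le_iff hk0 (hkl.trans_le le_top).ne, one_mul] at this
    exact this.trans_lt hkl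

end AbsYoung

/-! ### Null sets under inversion and under the projection of `G` onto `G/H` -/

theorem measure_isOpen_le_of_forall_integral_le {X : Type*} [TopologicalSpace X] [T2Space X]
    [LocallyCompactSpace X] [MeasurableSpace X] [BorelSpace X] {ν : Measure X} [ν.Regular]
    {V : Set X} (hV : IsOpen V) {B : ℝ≥0∞}
    (h : ∀ ψ : C(X, ℝ), HasCompactSupport ψ → tsupport ψ ⊆ V → (∀ x, ψ x ∈ Icc 0 1) →
      ENNReal.ofReal (∫ x, ψ x ∂ν) ≤ B) : ν V ≤ B := by
  rw [hV.measure_eq_iSup_isCompact]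
  refine iSup₂_le fun K hKV => iSup_le fun hK => ?_
  obtain ⟨ψ, hψK, hψc, hψV, hψ⟩ := exists_continuousMap_one_of_isCompact_subset_isOpen hK hV hKV
  refine le_trans ?_ (h ψ hψc hψV hψ)
  rw [ofReal_integral_eq_lintegral_ofReal (ψ.continuous.integrable_of_hasCompactSupport hψc)
    (Eventually.of_forall fun x => (hψ x).1), ← lintegral_indicator_one hK.measurableSet]
  refine lintegral_mono fun x => ?_
  by_cases hx : x ∈ K
  · simp [hx, hψK hx]
  · simp [hx]

theorem ofReal_integral_le_measure {X : Type*} [TopologicalSpace X] [MeasurableSpace X]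
    [BorelSpace X] {ν : Measure X} {V : Set X} (hV : MeasurableSet V) {ψ : X → ℝ}
    (hi : Integrable ψ ν) (hψV : Function.support ψ ⊆ V) (hψ : ∀ x, ψ x ∈ Icc (0 : ℝ) 1) :
    ENNReal.ofReal (∫ x, ψ x ∂ν) ≤ ν V := by
  rw [ofReal_integral_eq_lintegral_ofReal hi (Eventually.of_forall fun x => (hψ x).1),
    ← lintegral_indicator_one hV]
  refine lintegral_mono fun x => ?_
  by_cases hx : x ∈ V
  · simpa [hx] using (hψ x).2
  · have : ψ x = 0 := Function.notMem_support.1 fun h => hx (hψV h)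
    simp [this]

section Group

variable {G : Type*} [Group G] [TopologicalSpace G] [IsTopologicalGroup G]
    [LocallyCompactSpace G] [T2Space G] [MeasurableSpace G] [BorelSpace G]

/-- Inversion preserves the null sets of a regular Haar measure. -/
theorem haar_inv_null (μ : Measure G) [μ.IsHaarMeasure] [μ.Regular] {N : Set G} (hN : μ N = 0) :
    μ.inv N = 0 := by
  obtain ⟨g, hg1, hgc, -, hg⟩ := exists_continuousMap_one_of_isCompact_subset_isOpen
    (isCompact_singleton (x := (1 : G))) isOpen_univ (subset_univ _)
  have hg1' : g 1 ≠ 0 := by rw [hg1 (mem_singleton _)]; simp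
  have g_nonneg : 0 ≤ (g : G → ℝ) := fun x => (hg x).1
  let D : G → ℝ := fun x => ∫ y, g (y⁻¹ * x) ∂μ.inv
  have D_cont : Continuous D := continuous_integral_apply_inv_mul g.continuous hgc
  have D_pos : ∀ x, 0 < D x := by
    intro x
    have C : Continuous (fun y ↦ g (y⁻¹ * x)) := by fun_prop
    apply (integral_pos_iff_support_of_nonneg _ _).2
    · apply C.isOpen_support.measure_pos μ.inv
      exact ⟨x, by simpa using hg1'⟩
    · exact fun y ↦ g_nonneg (y⁻¹ * x)
    · apply C.integrable_of_hasCompactSupport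
      exact HasCompactSupport.comp_homeomorph (f := g) hgc ((Homeomorph.inv G).trans (Homeomorph.mulRight x))
  set c := ∫ x, g x ∂μ with hc
  have c_pos : 0 < c := g.continuous.integral_pos_of_hasCompactSupport_nonneg_nonzero hgc
    g_nonneg hg1'
  -- The left invariant `μ` is compared with the right invariant `μ.inv`. Tested on `C_c(G)`, the
  -- measure `μ.inv` has the continuous density `D / c` with respect to `μ`.
  have key : ∀ ψ : G → ℝ, Continuous ψ → HasCompactSupport ψ →
      ∫ x, ψ x * D x ∂μ = (∫ x, ψ x ∂μ.inv) * c := by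
    intro ψ hψ hψc
    refine (Measure.integral_isMulLeftInvariant_isMulRightInvariant_combo (μ := μ) (ν := μ.inv)
      (hψ.mul D_cont) hψc.mul_right g.continuous hgc g_nonneg hg1').trans ?_
    congr 2
    ext x
    exact mul_inv_cancel_right₀ (D_pos x).ne' (ψ x)
  -- The density is locally bounded only, so the comparison is made on the open sets `{D < k}`,
  -- which exhaust `G`.
  have hopen : ∀ (k : ℕ) (V : Set G), IsOpen V → V ⊆ {x | D x < k} →
      μ.inv V ≤ ENNReal.ofReal (c⁻¹ * k) * μ V := by
    intro k V hV hVk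
    refine measure_isOpen_le_of_forall_integral_le hV fun ψ hψc hψV hψ => ?_
    have h1 : ∫ x, ψ x ∂μ.inv = c⁻¹ * ∫ x, ψ x * D x ∂μ := by
      rw [key ψ ψ.continuous hψc]
      field_simp
    have i1 := ψ.continuous.integrable_of_hasCompactSupport (μ := μ) hψc
    have h2 : ∫ x, ψ x * D x ∂μ ≤ k * ∫ x, ψ x ∂μ := by
      rw [← integral_const_mul]
      refine integral_mono ((ψ.continuous.mul D_cont).integrable_of_hasCompactSupport
        hψc.mul_right) (i1.const_mul _) fun x => ?_
      by_cases hx : x ∈ V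
      · have := (show D x < k from hVk hx).le
        dsimp only
        rw [mul_comm]
        exact mul_le_mul_of_nonneg_right this (hψ x).1
      · have : ψ x = 0 := image_eq_zero_of_notMem_tsupport fun h => hx (hψV h)
        simp [this]
    calc ENNReal.ofReal (∫ x, ψ x ∂μ.inv) ≤ ENNReal.ofReal (c⁻¹ * k * ∫ x, ψ x ∂μ) := by
          refine ENNReal.ofReal_le_ofReal ?_
          rw [h1, mul_assoc]
          exact mul_le_mul_of_nonneg_left h2 (inv_pos.2 c_pos).le
      _ = ENNReal.ofReal (c⁻¹ * k) * ENNReal.ofReal (∫ x, ψ x ∂μ) :=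
          ENNReal.ofReal_mul (by positivity)
      _ ≤ _ := by
          gcongr
          exact ofReal_integral_le_measure hV.measurableSet i1
            ((subset_tsupport _).trans hψV) hψ
  have hN' : ∀ k : ℕ, μ.inv (N ∩ {x | D x < k}) = 0 := by
    intro k
    set C := ENNReal.ofReal (c⁻¹ * k)
    refine le_antisymm (ENNReal.le_of_forall_pos_le_add fun ε hε _ => ?_) zero_le
    have hδ : (ε : ℝ≥0∞) / (C + 1) ≠ 0 := by
      simp [ENNReal.div_eq_zero_iff, hε.ne', C]
    obtain ⟨V, hNV, hV, hVε⟩ := N.exists_isOpen_lt_of_lt (μ := μ) (ε / (C + 1))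
      (by rw [hN]; exact pos_iff_ne_zero.2 hδ)
    have hO : IsOpen {x | D x < k} := isOpen_lt D_cont continuous_const
    calc μ.inv (N ∩ {x | D x < k}) ≤ μ.inv (V ∩ {x | D x < k}) := by gcongr
      _ ≤ C * μ (V ∩ {x | D x < k}) := hopen k _ (hV.inter hO) inter_subset_right
      _ ≤ (C + 1) * (ε / (C + 1)) := by
          gcongr
          · simp
          · exact (measure_mono inter_subset_left).trans hVε.le
      _ ≤ 0 + ε := by rw [zero_add]; exact ENNReal.mul_div_le
  refine measure_mono_null (fun x hx => ?_) (measure_iUnion_null hN')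
  obtain ⟨k, hk⟩ := exists_nat_gt (D x)
  exact mem_iUnion.2 ⟨k, hx, hk⟩

variable (H : Subgroup G) [CompactSpace H]

instance : T2Space (G ⧸ H) := by
  rw [t2Space_iff_of_isOpenQuotientMap (QuotientGroup.isOpenQuotientMap_mk (N := H))]
  have : {q : G × G | (QuotientGroup.mk q.1 : G ⧸ H) = QuotientGroup.mk q.2} =
      (fun q : G × G => q.1⁻¹ * q.2) ⁻¹' H := by
    ext q
    simp [QuotientGroup.eq]
  rw [this]
  exact (isCompact_iff_compactSpace.2 ‹_› : IsCompact (H : Set G)).isClosed.preimage (by fun_prop)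

/-- The projection is proper: it is closed because `H` is compact, and its fibres are the compact
sets `xH`. -/
theorem isCompact_preimage_mk {K : Set (G ⧸ H)} (hK : IsCompact K) :
    IsCompact ((QuotientGroup.mk : G → G ⧸ H) ⁻¹' K) := by
  have hH : IsCompact (H : Set G) := isCompact_iff_compactSpace.2 ‹_›
  refine IsProperMap.isCompact_preimage ?_ hK
  rw [isProperMap_iff_isClosedMap_and_compact_fibers]
  refine ⟨continuous_quotient_mk', QuotientGroup.isClosedMap_coe hH, fun z => ?_⟩
  induction z using QuotientGroup.induction_on with
  | H x =>
    have : (QuotientGroup.mk : G → G ⧸ H) ⁻¹' {↑x} = (fun h => x * h) '' (H : Set G) := by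
      ext y
      simp only [mem_preimage, mem_singleton_iff, image_mul_left, SetLike.mem_coe]
      rw [eq_comm, QuotientGroup.eq]
    rw [this]
    exact hH.image (by fun_prop)

instance : IsProbabilityMeasure (haarProb H) := ⟨by
  simpa [haarProb] using Measure.haarMeasure_self
    (K₀ := (⊤ : TopologicalSpace.PositiveCompacts H))⟩

variable {H} [MeasurableSpace (G ⧸ H)] [BorelSpace (G ⧸ H)] {μ : Measure G} {m : Measure (G ⧸ H)}

/-- The pullback of `ψ` is compactly supported since the projection is proper, and its average over
`H` is `ψ` because `dh` has mass one. -/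
theorem WeilFormula.integral_eq (hm : WeilFormula μ H m) (ψ : C(G ⧸ H, ℝ))
    (hψ : HasCompactSupport ψ) : ∫ z, ψ z ∂m = ∫ x : G, ψ (x : G ⧸ H) ∂μ := by
  let f : C_c(G, ℂ) :=
    ⟨⟨fun x => (ψ (x : G ⧸ H) : ℂ), by
      have := continuous_quotient_mk' (s := QuotientGroup.leftRel H)
      exact Complex.continuous_ofReal.comp (ψ.continuous.comp this)⟩, by
      refine HasCompactSupport.intro (isCompact_preimage_mk H hψ) fun x hx => ?_
      have : ψ (x : G ⧸ H) = 0 := image_eq_zero_of_notMem_tsupport hx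
      simp [this]⟩
  have h := hm f
  have hf : ∀ x, f x = (ψ (x : G ⧸ H) : ℂ) := fun _ => rfl
  have e : ∀ z, cosetAverage H f z = (ψ z : ℂ) := by
    intro z
    induction z using QuotientGroup.induction_on with
    | H x =>
      change ∫ h : H, f (x * (h : G)) ∂(haarProb H) = _
      simp only [hf]
      have : ∀ h : H, ((x * h : G) : G ⧸ H) = x := fun h => by simp
      simp [this]
  simp only [e, hf, integral_complex_ofReal] at h
  exact_mod_cast h

theorem WeilFormula.measure_le_preimage [m.Regular] [μ.IsHaarMeasure] (hm : WeilFormula μ H m)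
    {W : Set (G ⧸ H)} (hW : IsOpen W) : m W ≤ μ ((QuotientGroup.mk : G → G ⧸ H) ⁻¹' W) := by
  have hq : Continuous (QuotientGroup.mk : G → G ⧸ H) := continuous_quotient_mk'
  refine measure_isOpen_le_of_forall_integral_le hW fun ψ hψc hψW hψ => ?_
  rw [hm.integral_eq ψ hψc]
  refine ofReal_integral_le_measure (hW.preimage hq).measurableSet ?_ (fun x hx => ?_)
    fun x => hψ _
  · exact (ψ.continuous.comp hq).integrable_of_hasCompactSupport
      (HasCompactSupport.intro (isCompact_preimage_mk H hψc) fun x hx =>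
        image_eq_zero_of_notMem_tsupport (f := ψ) hx)
  · exact hψW (subset_tsupport _ hx)

theorem WeilFormula.preimage_le_measure [m.Regular] [μ.IsHaarMeasure] [μ.Regular]
    (hm : WeilFormula μ H m) {W : Set (G ⧸ H)} (hW : IsOpen W) :
    μ ((QuotientGroup.mk : G → G ⧸ H) ⁻¹' W) ≤ m W := by
  have hq : Continuous (QuotientGroup.mk : G → G ⧸ H) := continuous_quotient_mk'
  rw [(hW.preimage hq).measure_eq_iSup_isCompact]
  refine iSup₂_le fun K hKW => iSup_le fun hK => ?_
  obtain ⟨ψ, hψK, hψc, hψW, hψ⟩ := exists_continuousMap_one_of_isCompact_subset_isOpen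
    (hK.image hq) hW (image_subset_iff.2 hKW)
  have i1 : Integrable (fun x : G => ψ (x : G ⧸ H)) μ :=
    (ψ.continuous.comp hq).integrable_of_hasCompactSupport
      (HasCompactSupport.intro (isCompact_preimage_mk H hψc) fun x hx =>
        image_eq_zero_of_notMem_tsupport (f := ψ) hx)
  refine le_trans ?_ (ofReal_integral_le_measure hW.measurableSet
    (ψ.continuous.integrable_of_hasCompactSupport hψc) ((subset_tsupport _).trans hψW) hψ)
  rw [hm.integral_eq ψ hψc, ofReal_integral_eq_lintegral_ofReal i1
    (Eventually.of_forall fun x => (hψ _).1), ← lintegral_indicator_one hK.measurableSet]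
  refine lintegral_mono fun x => ?_
  by_cases hx : x ∈ K
  · simp [hx, hψK (mem_image_of_mem _ hx)]
  · simp [hx]

theorem WeilFormula.preimage_null [m.Regular] [μ.IsHaarMeasure] [μ.Regular]
    (hm : WeilFormula μ H m) {N : Set (G ⧸ H)} (hN : m N = 0) :
    μ ((QuotientGroup.mk : G → G ⧸ H) ⁻¹' N) = 0 := by
  refine le_antisymm (ENNReal.le_of_forall_pos_le_add fun ε hε _ => ?_) zero_le
  obtain ⟨V, hNV, hV, hVε⟩ := N.exists_isOpen_lt_of_lt (μ := m) ε (by simpa [hN] using hε)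
  rw [zero_add]
  exact (measure_mono (preimage_mono hNV)).trans ((hm.preimage_le_measure hV).trans hVε.le)

theorem WeilFormula.null_of_preimage [m.Regular] [μ.IsHaarMeasure] [μ.Regular]
    (hm : WeilFormula μ H m) {N : Set (G ⧸ H)}
    (hN : μ ((QuotientGroup.mk : G → G ⧸ H) ⁻¹' N) = 0) : m N = 0 := by
  refine le_antisymm (ENNReal.le_of_forall_pos_le_add fun ε hε _ => ?_) zero_le
  obtain ⟨O, hNO, hO, hOε⟩ := Set.exists_isOpen_lt_of_lt (μ := μ)
    ((QuotientGroup.mk : G → G ⧸ H) ⁻¹' N) ε (by simpa [hN] using hε)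
  have hH : IsCompact (H : Set G) := isCompact_iff_compactSpace.2 ‹_›
  -- `W` consists of the cosets contained in `O`; it is open because the projection is a closed map.
  let W : Set (G ⧸ H) := (QuotientGroup.mk '' Oᶜ)ᶜ
  have hW : IsOpen W := (QuotientGroup.isClosedMap_coe hH _ hO.isClosed_compl).isOpen_compl
  have hNW : N ⊆ W := by
    rintro z hz ⟨x, hx, rfl⟩
    exact hx (hNO hz)
  have hWO : (QuotientGroup.mk : G → G ⧸ H) ⁻¹' W ⊆ O := by
    intro x hx
    by_contra hcon
    exact hx (mem_image_of_mem _ hcon)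
  rw [zero_add]
  calc m N ≤ m W := measure_mono hNW
    _ ≤ μ ((QuotientGroup.mk : G → G ⧸ H) ⁻¹' W) := hm.measure_le_preimage hW
    _ ≤ μ O := measure_mono hWO
    _ ≤ ε := hOε.le

/-- If a property holds at almost every coset then, for every `x`, it holds at `y⁻¹ xH` for almost
every coset `yH`. -/
theorem WeilFormula.ae_of_ae_inv_smul [m.Regular] [μ.IsHaarMeasure] [μ.Regular]
    (hm : WeilFormula μ H m) {p : G ⧸ H → Prop} (hp : ∀ᵐ z ∂m, p z) (z : G ⧸ H)
    {r : G ⧸ H → Prop} (hr : ∀ y : G, p (y⁻¹ • z) → r y) : ∀ᵐ w ∂m, r w := by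
  induction z using QuotientGroup.induction_on with
  | H x =>
    refine hm.null_of_preimage ?_
    have h1 : μ.inv ((QuotientGroup.mk : G → G ⧸ H) ⁻¹' {z | ¬ p z}) = 0 :=
      haar_inv_null μ (hm.preimage_null hp)
    rw [Measure.inv_apply] at h1
    -- The `y` with `y⁻¹xH` in the bad set form the left translate by `x` of the inverse of its
    -- preimage. The predicate `r` is needed because `y⁻¹xH` itself is not a function of `yH`.
    have h2 := (measure_preimage_mul μ x⁻¹
      ((QuotientGroup.mk : G → G ⧸ H) ⁻¹' {z | ¬ p z})⁻¹).trans h1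
    refine measure_mono_null (t := _) ?_ h2
    intro y hy hpy
    exact hy (hr y (by simpa using hpy))

end Group

/-! ### Interchange of integrals without σ-finiteness -/

section Fubini

theorem continuous_integral_of_uncurry {X Y : Type*} [TopologicalSpace X] [TopologicalSpace Y]
    [MeasurableSpace Y] [OpensMeasurableSpace Y] {E : Type*} [NormedAddCommGroup E] [NormedSpace ℝ E]
    {ν : Measure Y} [IsFiniteMeasureOnCompacts ν] {f : X → Y → E}
    (hf : Continuous (Function.uncurry f)) {L : Set Y} (hL : IsCompact L)
    (hfL : ∀ x y, y ∉ L → f x y = 0) : Continuous fun x => ∫ y, f x y ∂ν := by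
  rw [← continuousOn_univ]
  exact continuousOn_integral_of_compact_support hL hf.continuousOn fun p x _ hx => hfL p x hx

variable {X Y : Type*} [TopologicalSpace X] [TopologicalSpace Y] [MeasurableSpace X]
  [MeasurableSpace Y] [OpensMeasurableSpace X] [OpensMeasurableSpace Y]

theorem lintegral_ofReal_swap_of_compact_support [T2Space X] [T2Space Y] {f : X → Y → ℝ}
    (hf : Continuous (Function.uncurry f)) (hf0 : ∀ x y, 0 ≤ f x y) {K : Set X} {L : Set Y}
    (hK : IsCompact K) (hL : IsCompact L) (hfK : ∀ x y, x ∉ K → f x y = 0)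
    (hfL : ∀ x y, y ∉ L → f x y = 0) {μ : Measure X} {ν : Measure Y}
    [IsFiniteMeasureOnCompacts μ] [IsFiniteMeasureOnCompacts ν] :
    ∫⁻ x, ∫⁻ y, ENNReal.ofReal (f x y) ∂ν ∂μ = ∫⁻ y, ∫⁻ x, ENNReal.ofReal (f x y) ∂μ ∂ν := by
  have hf' : Continuous (Function.uncurry fun y x => f x y) := hf.comp continuous_swap
  have hc : HasCompactSupport (Function.uncurry f) := by
    refine HasCompactSupport.intro (hK.prod hL) fun p hp => ?_
    by_cases h : p.1 ∈ K
    · exact hfL _ _ fun h2 => hp ⟨h, h2⟩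
    · exact hfK _ _ h
  have i1 : ∀ x, Integrable (fun y => f x y) ν := fun x =>
    (hf.comp (Continuous.prodMk_right x)).integrable_of_hasCompactSupport
      (HasCompactSupport.intro hL fun y hy => hfL x y hy)
  have i2 : ∀ y, Integrable (fun x => f x y) μ := fun y =>
    (hf.comp (Continuous.prodMk_left y)).integrable_of_hasCompactSupport
      (HasCompactSupport.intro hK fun x hx => hfK x y hx)
  have j1 : Integrable (fun x => ∫ y, f x y ∂ν) μ :=
    (continuous_integral_of_uncurry hf hL hfL).integrable_of_hasCompactSupport
      (HasCompactSupport.intro hK fun x hx => by simp [hfK x _ hx])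
  have j2 : Integrable (fun y => ∫ x, f x y ∂μ) ν :=
    (continuous_integral_of_uncurry hf' hK fun y x => hfK x y).integrable_of_hasCompactSupport
      (HasCompactSupport.intro hL fun y hy => by simp [hfL _ y hy])
  calc ∫⁻ x, ∫⁻ y, ENNReal.ofReal (f x y) ∂ν ∂μ
      = ∫⁻ x, ENNReal.ofReal (∫ y, f x y ∂ν) ∂μ := by
        refine lintegral_congr fun x => ?_
        rw [ofReal_integral_eq_lintegral_ofReal (i1 x) (Eventually.of_forall (hf0 x))]
    _ = ENNReal.ofReal (∫ x, ∫ y, f x y ∂ν ∂μ) :=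
        (ofReal_integral_eq_lintegral_ofReal j1
          (Eventually.of_forall fun x => integral_nonneg (hf0 x))).symm
    _ = ENNReal.ofReal (∫ y, ∫ x, f x y ∂μ ∂ν) := by
        rw [integral_integral_swap_of_hasCompactSupport hf hc]
    _ = ∫⁻ y, ENNReal.ofReal (∫ x, f x y ∂μ) ∂ν :=
        ofReal_integral_eq_lintegral_ofReal j2
          (Eventually.of_forall fun y => integral_nonneg fun x => hf0 x y)
    _ = _ := by
        refine lintegral_congr fun y => ?_
        rw [ofReal_integral_eq_lintegral_ofReal (i2 y) (Eventually.of_forall fun x => hf0 x y)]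

end Fubini

theorem YoungFunction.ext_enorm_div (φ : YoungFunction) [φ.Finite] (z : ℂ) {k : ℝ≥0∞}
    (hk : k ≠ 0) (hk' : k ≠ ∞) :
    φ.ext (‖z‖ₑ / k) = ENNReal.ofReal (φ.real (‖z‖ / k.toReal)) := by
  have h : 0 < k.toReal := ENNReal.toReal_pos hk hk'
  rw [φ.ofReal_real, ← φ.ext_ofReal (by positivity), ENNReal.ofReal_div_of_pos h,
    ENNReal.ofReal_toReal hk', ofReal_norm]

theorem YoungFunction.real_nonneg (φ : YoungFunction) (x : ℝ) : 0 ≤ φ.real x :=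
  ENNReal.toReal_nonneg

theorem YoungFunction.real_zero (φ : YoungFunction) : φ.real 0 = 0 := by
  simp [YoungFunction.real, φ.map_zero]

theorem elux_comp_measurePreserving {X : Type*} [MeasurableSpace X] {φ : YoungFunction}
    {m : Measure X} {T : X → X} (hT : MeasurePreserving T m m) {u : X → ℝ≥0∞}
    (hu : Measurable u) : elux φ m (fun x => u (T x)) = elux φ m u := by
  unfold elux
  congr 1
  ext k
  simp only [mem_ofPred_eq, and_congr_right_iff]
  intro _
  rw [hT.lintegral_comp (f := fun x => φ.ext (u x / k)) (φ.measurable_ext.comp (hu.div_const k))]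

theorem elux_compactlySupported_lt_top {X : Type*} [TopologicalSpace X] [MeasurableSpace X]
    [BorelSpace X] {φ : YoungFunction} [φ.Finite] {m : Measure X} [IsFiniteMeasureOnCompacts m]
    (k : C_c(X, ℂ)) : elux φ m (fun x => ‖k x‖ₑ) < ∞ := by
  have hm : AEStronglyMeasurable k m := k.continuous.measurable.aestronglyMeasurable
  rw [elux_congr_ae (v := fun x => ‖(AEEqFun.mk k hm) x‖ₑ)
    (by filter_upwards [AEEqFun.coeFn_mk k hm] with x hx; rw [hx]), ← mem_orliczSpace_iff]
  refine ⟨1, one_pos, ?_⟩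
  have hi : Integrable (fun x => φ.real ‖k x‖) m :=
    (φ.continuous_real.comp k.continuous.norm).integrable_of_hasCompactSupport
      (k.hasCompactSupport.comp_left (g := fun z => φ.real ‖z‖) (by simp [φ.real_zero]))
  have h2 := ofReal_integral_eq_lintegral_ofReal hi
    (Eventually.of_forall fun _ => φ.real_nonneg _)
  simp only [φ.ofReal_real] at h2
  refine lt_of_eq_of_lt (b := ∫⁻ x, φ.toFun ‖k x‖ ∂m) (lintegral_congr_ae ?_)
    (h2 ▸ ENNReal.ofReal_lt_top)
  filter_upwards [AEEqFun.coeFn_mk k hm] with x hx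
  rw [hx]
  simp

/-! ### The operator `J` and the convolution on `C_c(G/H)` -/

section Coset

variable {G : Type*} [Group G] [TopologicalSpace G] [IsTopologicalGroup G]
    [LocallyCompactSpace G] [T2Space G] [MeasurableSpace G] [BorelSpace G]
    (H : Subgroup G) [CompactSpace H]

theorem continuous_average {g : G ⧸ H → ℂ} (hg : Continuous g) : Continuous (average H g) :=
  continuous_integral_of_uncurry (f := fun (z : G ⧸ H) (h : H) => g ((h : G) • z))
    (hg.comp (by fun_prop)) isCompact_univ fun _ _ h => (h (mem_univ _)).elim

theorem hasCompactSupport_average {g : G ⧸ H → ℂ} (hg : HasCompactSupport g) :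
    HasCompactSupport (average H g) := by
  have hK : IsCompact ((fun p : H × (G ⧸ H) => (p.1 : G)⁻¹ • p.2) '' (univ ×ˢ tsupport g)) :=
    (isCompact_univ.prod hg).image (by fun_prop)
  refine HasCompactSupport.intro hK fun z hz => ?_
  have : ∀ h : H, g ((h : G) • z) = 0 := fun h => by
    refine image_eq_zero_of_notMem_tsupport fun hcon => hz ?_
    exact ⟨(h, (h : G) • z), ⟨mem_univ _, hcon⟩, by simp⟩
  simp [average, this]

/-- The operator `J` on `C_c(G/H)`. -/
noncomputable def averageCc : C_c(G ⧸ H, ℂ) →ₗ[ℂ] C_c(G ⧸ H, ℂ) where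
  toFun g := ⟨⟨average H g, continuous_average H g.continuous⟩,
    hasCompactSupport_average H g.hasCompactSupport⟩
  map_add' f g := by
    ext z
    have hi : ∀ k : C_c(G ⧸ H, ℂ), Integrable (fun h : H => k ((h : G) • z)) (haarProb H) :=
      fun k => (k.continuous.comp (by fun_prop :
        Continuous fun h : H => (h : G) • z)).integrable_of_hasCompactSupport
        (HasCompactSupport.of_compactSpace _)
    exact integral_add (hi f) (hi g)
  map_smul' c g := by
    ext z
    exact integral_const_mul c _

@[simp] theorem averageCc_apply (g : C_c(G ⧸ H, ℂ)) (z : G ⧸ H) :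
    averageCc H g z = average H g z := rfl

theorem averageCc_leftInvariant (g : C_c(G ⧸ H, ℂ)) : LeftInvariant H (averageCc H g) :=
  average_leftInvariant H g

variable {H}

theorem translate_coe {F : G ⧸ H → ℂ} (hF : LeftInvariant H F) (z : G ⧸ H) (y : G) :
    translate H F hF z y = F (y⁻¹ • z) := rfl

/-- The projection in the first variable is an open quotient map also after taking the product with
`G/H`, so continuity can be checked on `G × G/H`. -/
theorem continuous_translate {F : G ⧸ H → ℂ} (hF : LeftInvariant H F) (hc : Continuous F) :
    Continuous fun p : (G ⧸ H) × (G ⧸ H) => translate H F hF p.2 p.1 := by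
  rw [← ((QuotientGroup.isOpenQuotientMap_mk (N := H)).prodMap
    (IsOpenQuotientMap.id (X := G ⧸ H))).continuous_comp_iff]
  exact hc.comp (by fun_prop : Continuous fun p : G × (G ⧸ H) => p.1⁻¹ • p.2)

/-- The product set of two sets of cosets. -/
def cosetMul (K L : Set (G ⧸ H)) : Set (G ⧸ H) :=
  (fun p : G × (G ⧸ H) => p.1 • p.2) '' (((QuotientGroup.mk : G → G ⧸ H) ⁻¹' K) ×ˢ L)

theorem isCompact_cosetMul {K L : Set (G ⧸ H)} (hK : IsCompact K) (hL : IsCompact L) :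
    IsCompact (cosetMul K L) :=
  ((isCompact_preimage_mk H hK).prod hL).image (by fun_prop)

theorem mul_translate_eq_zero {f F : G ⧸ H → ℂ} (hF : LeftInvariant H F) {z : G ⧸ H}
    (hz : z ∉ cosetMul (tsupport f) (tsupport F)) (w : G ⧸ H) :
    f w * translate H F hF z w = 0 := by
  induction w using QuotientGroup.induction_on with
  | H y =>
    rw [translate_coe]
    by_cases hy : (y : G ⧸ H) ∈ tsupport f
    · have : F (y⁻¹ • z) = 0 := by
        refine image_eq_zero_of_notMem_tsupport fun hcon => hz ?_
        exact ⟨(y, y⁻¹ • z), ⟨hy, hcon⟩, by simp⟩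
      rw [this, mul_zero]
    · rw [image_eq_zero_of_notMem_tsupport hy, zero_mul]

variable [MeasurableSpace (G ⧸ H)] [BorelSpace (G ⧸ H)] {m : Measure (G ⧸ H)}

/-- Minkowski's inequality for `dh`: every translate of `g` has the norm of `g`, as `m` is
invariant. -/
theorem elux_average_le {φ : YoungFunction} [φ.Finite] [IsFiniteMeasureOnCompacts m]
    [SMulInvariantMeasure G (G ⧸ H) m] (g : C_c(G ⧸ H, ℂ)) :
    elux φ m (fun z => ‖average H g z‖ₑ) ≤ elux φ m (fun z => ‖g z‖ₑ) := by
  have hcont : Continuous fun p : H × (G ⧸ H) => g ((p.1 : G) • p.2) :=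
    g.continuous.comp (by fun_prop)
  refine le_trans (elux_mono fun z => enorm_integral_le_lintegral_enorm _) ?_
  refine (elux_lintegral_le (b := fun (h : H) (z : G ⧸ H) => ‖g ((h : G) • z)‖ₑ)
    (L := elux φ m (fun z => ‖g z‖ₑ)) (fun z => ?_) (fun h => ?_) fun k hk hk' => ?_).trans ?_
  · exact (hcont.comp (Continuous.prodMk_left z)).measurable.enorm.aemeasurable
  · exact (elux_comp_measurePreserving (measurePreserving_smul (h : G) m)
      g.continuous.measurable.enorm).le
  · simp only [φ.ext_enorm_div _ hk hk']
    have hK : IsCompact ((fun p : H × (G ⧸ H) => (p.1 : G)⁻¹ • p.2) '' (univ ×ˢ tsupport g)) :=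
      (isCompact_univ.prod g.hasCompactSupport).image (by fun_prop)
    refine (lintegral_ofReal_swap_of_compact_support
      (f := fun (h : H) (z : G ⧸ H) => φ.real (‖g ((h : G) • z)‖ / k.toReal))
      (φ.continuous_real.comp (hcont.norm.div_const _)) (fun _ _ => φ.real_nonneg _)
      isCompact_univ hK (fun _ _ h => (h (mem_univ _)).elim) fun h z hz => ?_).ge
    have : g ((h : G) • z) = 0 := by
      refine image_eq_zero_of_notMem_tsupport fun hcon => hz ?_
      exact ⟨(h, (h : G) • z), ⟨mem_univ _, hcon⟩, by simp⟩
    simp [this, φ.real_zero]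
  · simp

/-- Young's inequality for the convolution with a left invariant function in `C_c(G/H)`. -/
theorem elux_lintegral_translate_le {φ : YoungFunction} [φ.Finite] [IsFiniteMeasureOnCompacts m]
    [SMulInvariantMeasure G (G ⧸ H) m] (f F : C_c(G ⧸ H, ℂ)) (hF : LeftInvariant H F) :
    elux φ m (fun z => ∫⁻ w, ‖f w‖ₑ * ‖translate H F hF z w‖ₑ ∂m) ≤
      (∫⁻ w, ‖f w‖ₑ ∂m) * elux φ m (fun z => ‖F z‖ₑ) := by
  have hκ := continuous_translate hF F.continuous
  have hfm : Measurable fun w => ‖f w‖ₑ := f.continuous.measurable.enorm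
  -- Minkowski's inequality for `|f| dm`, of total mass `‖f‖₁`; for fixed `w = yH` the function `z ↦
  -- F (y⁻¹z)` has the norm of `F`.
  let ν : Measure (G ⧸ H) := m.withDensity fun w => ‖f w‖ₑ
  have hfi : ∫⁻ w, ‖f w‖ₑ ∂m < ∞ :=
    (f.continuous.integrable_of_hasCompactSupport f.hasCompactSupport).2
  have hν : ∀ v : G ⧸ H → ℝ≥0∞, ∫⁻ w, v w ∂ν = ∫⁻ w, ‖f w‖ₑ * v w ∂m := fun v =>
    lintegral_withDensity_eq_lintegral_mul_non_measurable m hfm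
      (Eventually.of_forall fun _ => enorm_lt_top) v
  have hνu : ν univ = ∫⁻ w, ‖f w‖ₑ ∂m := by
    rw [← lintegral_one, hν]
    simp
  have : IsFiniteMeasure ν := ⟨by rwa [hνu]⟩
  rw [← hνu]
  simp only [← hν]
  refine elux_lintegral_le (b := fun w z => ‖translate H F hF z w‖ₑ) (fun z => ?_) (fun w => ?_)
    fun k hk hk' => ?_
  · exact (hκ.comp (Continuous.prodMk_left z)).measurable.enorm.aemeasurable
  · induction w using QuotientGroup.induction_on with
    | H y =>
      exact (elux_comp_measurePreserving (measurePreserving_smul y⁻¹ m)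
        F.continuous.measurable.enorm).le
  · simp only [hν]
    have e1 : ∀ w z, ‖f w‖ₑ * φ.ext (‖translate H F hF z w‖ₑ / k) =
        ENNReal.ofReal (‖f w‖ * φ.real (‖translate H F hF z w‖ / k.toReal)) := fun w z => by
      rw [φ.ext_enorm_div _ hk hk', ← ofReal_norm, ← ENNReal.ofReal_mul (norm_nonneg _)]
    have e2 : ∀ w, ‖f w‖ₑ * ∫⁻ z, φ.ext (‖translate H F hF z w‖ₑ / k) ∂m =
        ∫⁻ z, ‖f w‖ₑ * φ.ext (‖translate H F hF z w‖ₑ / k) ∂m := fun w =>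
      (lintegral_const_mul' _ _ enorm_ne_top).symm
    simp only [e2, e1]
    have hzero : ∀ w z, f w * translate H F hF z w = 0 →
        ‖f w‖ * φ.real (‖translate H F hF z w‖ / k.toReal) = 0 := by
      intro w z h
      rcases mul_eq_zero.1 h with h | h <;> simp [h, φ.real_zero]
    refine (lintegral_ofReal_swap_of_compact_support
      (f := fun w z => ‖f w‖ * φ.real (‖translate H F hF z w‖ / k.toReal))
      ((f.continuous.norm.comp continuous_fst).mul
        (φ.continuous_real.comp (hκ.norm.div_const _)))
      (fun _ _ => mul_nonneg (norm_nonneg _) (φ.real_nonneg _)) f.hasCompactSupport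
      (isCompact_cosetMul f.hasCompactSupport F.hasCompactSupport) (fun w z hw => ?_)
      fun w z hz => hzero w z (mul_translate_eq_zero hF hz w)).ge
    rw [image_eq_zero_of_notMem_tsupport hw]
    simp

theorem integrable_mul_translate [IsFiniteMeasureOnCompacts m] (f F : C_c(G ⧸ H, ℂ))
    (hF : LeftInvariant H F) (z : G ⧸ H) :
    Integrable (fun w => f w * translate H F hF z w) m := by
  refine (f.continuous.mul ((continuous_translate hF F.continuous).comp
    (Continuous.prodMk_left z))).integrable_of_hasCompactSupport f.hasCompactSupport.mul_right

theorem conv_eq (f g : C_c(G ⧸ H, ℂ)) (z : G ⧸ H) : conv H m f g z =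
    ∫ w, f w * translate H (averageCc H g) (averageCc_leftInvariant H g) z w ∂m := rfl

variable (H m) in
/-- The convolution on `C_c(G/H)`. -/
noncomputable def convCc [IsFiniteMeasureOnCompacts m] (f g : C_c(G ⧸ H, ℂ)) : C_c(G ⧸ H, ℂ) where
  toFun := conv H m f g
  continuous_toFun := by
    refine continuous_integral_of_uncurry
      (f := fun z w => f w * translate H (averageCc H g) (averageCc_leftInvariant H g) z w)
      ?_ f.hasCompactSupport fun z w hw => ?_
    · exact (f.continuous.comp continuous_snd).mul
        ((continuous_translate (averageCc_leftInvariant H g) (averageCc H g).continuous).comp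
          continuous_swap)
    · rw [image_eq_zero_of_notMem_tsupport hw, zero_mul]
  hasCompactSupport' := by
    refine HasCompactSupport.intro (isCompact_cosetMul f.hasCompactSupport
      (averageCc H g).hasCompactSupport) fun z hz => ?_
    rw [conv_eq]
    simp only [mul_translate_eq_zero (averageCc_leftInvariant H g) hz, integral_zero]

theorem convCc_apply [IsFiniteMeasureOnCompacts m] (f g : C_c(G ⧸ H, ℂ)) (z : G ⧸ H) :
    convCc H m f g z = conv H m f g z := rfl

theorem translate_averageCc_add (g g' : C_c(G ⧸ H, ℂ)) (z w : G ⧸ H) :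
    translate H (averageCc H (g + g')) (averageCc_leftInvariant H _) z w =
      translate H (averageCc H g) (averageCc_leftInvariant H _) z w +
      translate H (averageCc H g') (averageCc_leftInvariant H _) z w := by
  induction w using QuotientGroup.induction_on with
  | H y => simp only [translate_coe, map_add, CompactlySupportedContinuousMap.add_apply]

theorem translate_averageCc_smul (c : ℂ) (g : C_c(G ⧸ H, ℂ)) (z w : G ⧸ H) :
    translate H (averageCc H (c • g)) (averageCc_leftInvariant H _) z w =
      c * translate H (averageCc H g) (averageCc_leftInvariant H _) z w := by
  induction w using QuotientGroup.induction_on with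
  | H y => simp only [translate_coe, map_smul, CompactlySupportedContinuousMap.smul_apply,
      smul_eq_mul]

variable (H m) in
/-- The convolution on `C_c(G/H)` as a bilinear map. -/
noncomputable def convBilin [IsFiniteMeasureOnCompacts m] :
    C_c(G ⧸ H, ℂ) →ₗ[ℂ] C_c(G ⧸ H, ℂ) →ₗ[ℂ] C_c(G ⧸ H, ℂ) :=
  LinearMap.mk₂ ℂ (convCc H m)
    (fun f f' g => by
      ext z
      simp only [CompactlySupportedContinuousMap.add_apply, convCc_apply, conv_eq, add_mul]
      exact integral_add (integrable_mul_translate _ _ _ _) (integrable_mul_translate _ _ _ _))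
    (fun c f g => by
      ext z
      simp only [CompactlySupportedContinuousMap.smul_apply, convCc_apply, conv_eq, smul_eq_mul]
      rw [← integral_const_mul]
      refine integral_congr_ae (Eventually.of_forall fun w => ?_)
      exact mul_assoc c _ _)
    (fun f g g' => by
      ext z
      simp only [CompactlySupportedContinuousMap.add_apply, convCc_apply, conv_eq,
        translate_averageCc_add, mul_add]
      exact integral_add (integrable_mul_translate _ _ _ _) (integrable_mul_translate _ _ _ _))
    (fun c f g => by
      ext z
      simp only [CompactlySupportedContinuousMap.smul_apply, convCc_apply, conv_eq, smul_eq_mul,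
        translate_averageCc_smul, mul_left_comm _ c]
      exact integral_const_mul c _)

theorem convBilin_apply [IsFiniteMeasureOnCompacts m] (f g : C_c(G ⧸ H, ℂ)) (z : G ⧸ H) :
    convBilin H m f g z = conv H m f g z := rfl

theorem elux_conv_le {φ : YoungFunction} [φ.Finite] [IsFiniteMeasureOnCompacts m]
    [SMulInvariantMeasure G (G ⧸ H) m] (f g : C_c(G ⧸ H, ℂ)) :
    elux φ m (fun z => ‖conv H m f g z‖ₑ) ≤
      (∫⁻ w, ‖f w‖ₑ ∂m) * elux φ m (fun z => ‖g z‖ₑ) := by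
  refine le_trans (elux_mono fun z => ?_) ((elux_lintegral_translate_le f (averageCc H g)
    (averageCc_leftInvariant H g)).trans (by gcongr; exact elux_average_le g))
  rw [conv_eq]
  refine (enorm_integral_le_lintegral_enorm _).trans_eq ?_
  simp only [enorm_mul]

end Coset

/-! ### `C_c` as a dense subspace of `L^φ` and of `L¹` -/

theorem luxemburgNorm_eq_ofReal_norm {X : Type*} [MeasurableSpace X] {φ : YoungFunction}
    {m : Measure X} (g : orliczSpace φ m) : luxemburgNorm φ m g.1 = ENNReal.ofReal ‖g‖ := by
  rw [ofReal_norm_orlicz, luxemburgNorm_eq_elux]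

section Embedding

variable {X : Type*} [TopologicalSpace X] [MeasurableSpace X] [BorelSpace X]
  (φ : YoungFunction) [φ.Finite] (m : Measure X) [IsFiniteMeasureOnCompacts m]

/-- The canonical map of `C_c(X)` to `L^φ`. -/
noncomputable def ccToOrlicz : C_c(X, ℂ) →ₗ[ℂ] orliczSpace φ m where
  toFun k := orliczMk k k.continuous.measurable.aestronglyMeasurable
    (elux_compactlySupported_lt_top k)
  map_add' _ _ := rfl
  map_smul' _ _ := rfl

theorem ccToOrlicz_coe (k : C_c(X, ℂ)) : (ccToOrlicz φ m k).1 =ᵐ[m] k :=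
  orliczMk_coe k.continuous.measurable.aestronglyMeasurable (elux_compactlySupported_lt_top k)

variable {φ m}

theorem ccToOrlicz_eq_of_ae_eq {k : C_c(X, ℂ)} {g : orliczSpace φ m} (h : g.1 =ᵐ[m] k) :
    g = ccToOrlicz φ m k :=
  Subtype.ext (AEEqFun.ext (h.trans (ccToOrlicz_coe φ m k).symm))

theorem ofReal_norm_ccToOrlicz (k : C_c(X, ℂ)) :
    ENNReal.ofReal ‖ccToOrlicz φ m k‖ = elux φ m (fun x => ‖k x‖ₑ) := by
  rw [ofReal_norm_orlicz]
  exact elux_congr_ae ((ccToOrlicz_coe φ m k).mono fun x hx => by simp only [hx])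

theorem ofReal_norm_ccToOrlicz_sub (k : C_c(X, ℂ)) (g : orliczSpace φ m) :
    ENNReal.ofReal ‖ccToOrlicz φ m k - g‖ = elux φ m (fun x => ‖k x - g.1 x‖ₑ) :=
  ofReal_norm_sub_orlicz (ccToOrlicz_coe φ m k) (ae_eq_refl _)

theorem tendsto_ccToOrlicz_iff {k : ℕ → C_c(X, ℂ)} {g : orliczSpace φ m} :
    Tendsto (fun n => luxemburgNorm φ m (fun x => k n x - g.1 x)) atTop (𝓝 0) ↔
      Tendsto (fun n => ccToOrlicz φ m (k n)) atTop (𝓝 g) := by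
  rw [tendsto_iff_edist_tendsto_0]
  simp only [edist_eq_enorm_sub, ← ofReal_norm, ofReal_norm_ccToOrlicz_sub, luxemburgNorm_eq_elux]

theorem denseRange_ccToOrlicz [T2Space X] [LocallyCompactSpace X] [m.Regular]
    (hΔ : DeltaTwo φ m) : DenseRange (ccToOrlicz φ m) := by
  refine EMetric.dense_iff.2 fun g ε hε => ?_
  obtain ⟨δ, hδ, hδε⟩ := exists_between hε
  obtain ⟨k, hk⟩ := exists_compactlySupported_elux_sub_le hΔ g.1.aestronglyMeasurable
    (elux_coe_lt_top g) hδ.ne'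
  refine ⟨ccToOrlicz φ m k, ?_, mem_range_self k⟩
  rw [Metric.mem_eball, edist_eq_enorm_sub, ← ofReal_norm, ofReal_norm_ccToOrlicz_sub]
  exact hk.trans_lt hδε

variable (m) in
/-- The canonical map of `C_c(X)` to `L¹`. -/
noncomputable def ccToL1 : C_c(X, ℂ) →ₗ[ℂ] Lp ℂ 1 m where
  toFun k := (k.continuous.memLp_of_hasCompactSupport k.hasCompactSupport).toLp k
  map_add' _ _ := rfl
  map_smul' _ _ := rfl

theorem ccToL1_coe (k : C_c(X, ℂ)) : ccToL1 m k =ᵐ[m] k :=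
  MemLp.coeFn_toLp (k.continuous.memLp_of_hasCompactSupport k.hasCompactSupport)

theorem ofReal_norm_ccToL1 (k : C_c(X, ℂ)) :
    ENNReal.ofReal ‖ccToL1 m k‖ = ∫⁻ x, ‖k x‖ₑ ∂m := by
  rw [ofReal_norm, Lp.enorm_def, eLpNorm_congr_ae (ccToL1_coe k), eLpNorm_one_eq_lintegral_enorm]

theorem ofReal_norm_ccToL1_sub (k : C_c(X, ℂ)) (f : Lp ℂ 1 m) :
    ENNReal.ofReal ‖ccToL1 m k - f‖ = eLpNorm (fun x => k x - f x) 1 m := by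
  rw [ofReal_norm, Lp.enorm_def]
  refine eLpNorm_congr_ae ?_
  filter_upwards [Lp.coeFn_sub (ccToL1 m k) f, ccToL1_coe (m := m) k] with x h1 h2
  rw [h1, Pi.sub_apply, h2]

theorem tendsto_ccToL1_iff {k : ℕ → C_c(X, ℂ)} {f : Lp ℂ 1 m} :
    Tendsto (fun n => eLpNorm (fun x => k n x - f x) 1 m) atTop (𝓝 0) ↔
      Tendsto (fun n => ccToL1 m (k n)) atTop (𝓝 f) := by
  rw [tendsto_iff_edist_tendsto_0]
  simp only [edist_eq_enorm_sub, ← ofReal_norm, ofReal_norm_ccToL1_sub]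

theorem elux_absYoung_Lp_lt_top (f : Lp ℂ 1 m) : elux absYoung m (fun x => ‖f x‖ₑ) < ∞ := by
  rw [elux_absYoung, ← eLpNorm_one_eq_lintegral_enorm]
  exact Lp.eLpNorm_lt_top f

theorem denseRange_ccToL1 [T2Space X] [LocallyCompactSpace X] [m.Regular] :
    DenseRange (ccToL1 m) := by
  refine EMetric.dense_iff.2 fun f ε hε => ?_
  obtain ⟨δ, hδ, hδε⟩ := exists_between hε
  obtain ⟨k, hk⟩ := exists_compactlySupported_elux_sub_le (deltaTwo_absYoung m)
    (Lp.aestronglyMeasurable f) (elux_absYoung_Lp_lt_top f) hδ.ne'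
  refine ⟨ccToL1 m k, ?_, mem_range_self k⟩
  rw [Metric.mem_eball, edist_eq_enorm_sub, ← ofReal_norm, ofReal_norm_ccToL1_sub,
    eLpNorm_one_eq_lintegral_enorm, ← elux_absYoung]
  exact hk.trans_lt hδε

end Embedding

/-! ### Approximating sequences with summable errors -/

section FastSequence

variable {X : Type*} [TopologicalSpace X] [MeasurableSpace X] [BorelSpace X]
  {φ : YoungFunction} [φ.Finite] {m : Measure X}

theorem exists_seq_tsum_elux_sub_ne_top [T2Space X] [LocallyCompactSpace X] [m.Regular]
    (hΔ : DeltaTwo φ m) {g : X → ℂ} (hg : AEStronglyMeasurable g m)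
    (h : elux φ m (fun x => ‖g x‖ₑ) < ∞) :
    ∃ k : ℕ → C_c(X, ℂ), ∑' n, elux φ m (fun x => ‖k n x - g x‖ₑ) ≠ ∞ := by
  obtain ⟨ε, hε, hsum⟩ := ENNReal.exists_pos_sum_of_countable' one_ne_zero ℕ
  choose k hk using fun n => exists_compactlySupported_elux_sub_le hΔ hg h (hε n).ne'
  exact ⟨k, ne_top_of_le_ne_top ENNReal.one_ne_top ((ENNReal.tsum_le_tsum hk).trans hsum.le)⟩

/-- The terms of the series whose partial sums are the given sequence. -/
noncomputable def increments (k : ℕ → C_c(X, ℂ)) : ℕ → C_c(X, ℂ)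
  | 0 => k 0
  | n + 1 => k (n + 1) - k n

/-- The zeroth increment is `k 0`, so the first `n + 1` of them telescope to `k n`. -/
theorem sum_increments (k : ℕ → C_c(X, ℂ)) (n : ℕ) :
    ∑ i ∈ Finset.range (n + 1), increments k i = k n := by
  induction n with
  | zero => simp [increments]
  | succ n ih => rw [Finset.sum_range_succ, ih, increments, add_sub_cancel]

theorem tsum_elux_increments_ne_top [IsFiniteMeasureOnCompacts m] {k : ℕ → C_c(X, ℂ)} {g : X → ℂ}
    (hg : AEStronglyMeasurable g m) (h : ∑' n, elux φ m (fun x => ‖k n x - g x‖ₑ) ≠ ∞) :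
    ∑' n, elux φ m (fun x => ‖increments k n x‖ₑ) ≠ ∞ := by
  have hk : ∀ n, AEStronglyMeasurable (fun x => k n x - g x) m := fun n =>
    (k n).continuous.measurable.aestronglyMeasurable.sub hg
  rw [tsum_eq_zero_add' ENNReal.summable]
  refine ENNReal.add_ne_top.2 ⟨(elux_compactlySupported_lt_top _).ne, ?_⟩
  have h1 : ∀ n, elux φ m (fun x => ‖increments k (n + 1) x‖ₑ) ≤
      elux φ m (fun x => ‖k (n + 1) x - g x‖ₑ) + elux φ m (fun x => ‖k n x - g x‖ₑ) := by
    intro n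
    refine le_trans (elux_mono fun x => ?_) (elux_add_le (hk (n + 1)).enorm (hk n).enorm)
    have : increments k (n + 1) x = (k (n + 1) x - g x) - (k n x - g x) := by
      simp [increments]
    rw [this]
    exact enorm_sub_le
  refine ne_top_of_le_ne_top ?_ (ENNReal.tsum_le_tsum h1)
  rw [ENNReal.tsum_add]
  refine ENNReal.add_ne_top.2 ⟨ne_top_of_le_ne_top h ?_, h⟩
  exact ENNReal.tsum_comp_le_tsum_of_injective (add_left_injective 1) _

end FastSequence

/-! ### The extensions to `L^φ` and `L¹ × L^φ`, and the integral formula -/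

section Coset

variable {G : Type*} [Group G] [TopologicalSpace G] [IsTopologicalGroup G]
    [LocallyCompactSpace G] [T2Space G] [MeasurableSpace G] [BorelSpace G]
    (H : Subgroup G) [CompactSpace H] [MeasurableSpace (G ⧸ H)] [BorelSpace (G ⧸ H)]
    (m : Measure (G ⧸ H)) [m.Regular] [SMulInvariantMeasure G (G ⧸ H) m]
    (φ : YoungFunction) [φ.Finite]

/-- The extension of `J` to `L^φ`. -/
noncomputable def averageExtension : orliczSpace φ m →L[ℂ] orliczSpace φ m :=
  (ccToOrlicz φ m ∘ₗ averageCc H).extendOfNorm (ccToOrlicz φ m)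

variable {φ m H}

theorem norm_ccToOrlicz_average_le (g : C_c(G ⧸ H, ℂ)) :
    ‖(ccToOrlicz φ m ∘ₗ averageCc H) g‖ ≤ 1 * ‖ccToOrlicz φ m g‖ := by
  rw [one_mul, ← ENNReal.ofReal_le_ofReal_iff (norm_nonneg _), LinearMap.comp_apply,
    ofReal_norm_ccToOrlicz, ofReal_norm_ccToOrlicz]
  exact elux_average_le g

theorem isAverageExtension_averageExtension (hΔ : DeltaTwo φ m) :
    IsAverageExtension H m φ (averageExtension H m φ).toLinearMap := by
  refine ⟨⟨1, fun g => ?_⟩, fun k g hg => ?_⟩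
  · rw [luxemburgNorm_eq_ofReal_norm, luxemburgNorm_eq_ofReal_norm, ENNReal.coe_one, one_mul]
    refine ENNReal.ofReal_le_ofReal ?_
    have := LinearMap.norm_extendOfNorm_apply_le (f := ccToOrlicz φ m ∘ₗ averageCc H)
      (e := ccToOrlicz φ m) (denseRange_ccToOrlicz hΔ) 1
      (norm_ccToOrlicz_average_le (H := H)) g
    rwa [one_mul] at this
  · rw [ccToOrlicz_eq_of_ae_eq hg]
    have h := LinearMap.extendOfNorm_eq (f := ccToOrlicz φ m ∘ₗ averageCc H)
      (e := ccToOrlicz φ m) (denseRange_ccToOrlicz hΔ)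
      ⟨1, norm_ccToOrlicz_average_le (H := H)⟩ k
    change (averageExtension H m φ (ccToOrlicz φ m k)).1 =ᵐ[m] _
    unfold averageExtension
    rw [h]
    exact ccToOrlicz_coe φ m (averageCc H k)

theorem IsAverageExtension.elux_sub_le {T : orliczSpace φ m →ₗ[ℂ] orliczSpace φ m}
    (hT : IsAverageExtension H m φ T) : ∃ C : ℝ≥0, ∀ (k : C_c(G ⧸ H, ℂ)) (g : orliczSpace φ m),
      elux φ m (fun z => ‖average H k z - (T g).1 z‖ₑ) ≤
        C * elux φ m (fun z => ‖k z - g.1 z‖ₑ) := by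
  obtain ⟨⟨C, hC⟩, hk⟩ := hT
  refine ⟨C, fun k g => ?_⟩
  have h := hC (ccToOrlicz φ m k - g)
  rw [luxemburgNorm_eq_ofReal_norm, luxemburgNorm_eq_ofReal_norm, map_sub,
    ofReal_norm_ccToOrlicz_sub,
    ofReal_norm_sub_orlicz (hk k _ (ccToOrlicz_coe φ m k)) (ae_eq_refl _)] at h
  exact h

theorem IsAverageExtension.unique (hΔ : DeltaTwo φ m)
    {T T' : orliczSpace φ m →ₗ[ℂ] orliczSpace φ m}
    (hT : IsAverageExtension H m φ T) (hT' : IsAverageExtension H m φ T') : T = T' := by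
  have hbound : ∀ S : orliczSpace φ m →ₗ[ℂ] orliczSpace φ m, IsAverageExtension H m φ S →
      Continuous S := by
    rintro S ⟨⟨C, hC⟩, -⟩
    refine AddMonoidHomClass.continuous_of_bound S C fun g => ?_
    have := hC g
    rw [luxemburgNorm_eq_ofReal_norm, luxemburgNorm_eq_ofReal_norm, ← ENNReal.ofReal_coe_nnreal,
      ← ENNReal.ofReal_mul (NNReal.coe_nonneg C)] at this
    exact (ENNReal.ofReal_le_ofReal_iff (mul_nonneg C.coe_nonneg (norm_nonneg _))).1 this
  refine LinearMap.ext fun g => congrFun ((denseRange_ccToOrlicz hΔ).equalizer (hbound T hT)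
    (hbound T' hT') (funext fun k => ?_)) g
  exact (ccToOrlicz_eq_of_ae_eq (k := averageCc H k) (hT.2 k _ (ccToOrlicz_coe φ m k))).trans
    (ccToOrlicz_eq_of_ae_eq (k := averageCc H k) (hT'.2 k _ (ccToOrlicz_coe φ m k))).symm

theorem norm_ccToOrlicz_conv_le (f g : C_c(G ⧸ H, ℂ)) :
    ‖(ccToOrlicz φ m ∘ₗ convBilin H m f) g‖ ≤ ‖ccToL1 m f‖ * ‖ccToOrlicz φ m g‖ := by
  rw [← ENNReal.ofReal_le_ofReal_iff (by positivity), ENNReal.ofReal_mul (norm_nonneg _),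
    LinearMap.comp_apply, ofReal_norm_ccToOrlicz, ofReal_norm_ccToOrlicz, ofReal_norm_ccToL1]
  exact elux_conv_le f g

/-- Convolution with a function in `C_c(G/H)`, as an operator on `L^φ`. -/
noncomputable def convOperator (f : C_c(G ⧸ H, ℂ)) : orliczSpace φ m →L[ℂ] orliczSpace φ m :=
  (ccToOrlicz φ m ∘ₗ convBilin H m f).extendOfNorm (ccToOrlicz φ m)

theorem convOperator_apply (hΔ : DeltaTwo φ m) (f g : C_c(G ⧸ H, ℂ)) :
    convOperator f (ccToOrlicz φ m g) = ccToOrlicz φ m (convBilin H m f g) :=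
  LinearMap.extendOfNorm_eq (f := ccToOrlicz φ m ∘ₗ convBilin H m f) (e := ccToOrlicz φ m)
    (denseRange_ccToOrlicz hΔ) ⟨_, norm_ccToOrlicz_conv_le f⟩ g

theorem convOperator_ext (hΔ : DeltaTwo φ m) {S S' : orliczSpace φ m →L[ℂ] orliczSpace φ m}
    (h : ∀ g : C_c(G ⧸ H, ℂ), S (ccToOrlicz φ m g) = S' (ccToOrlicz φ m g)) : S = S' :=
  ContinuousLinearMap.ext fun g => congrFun ((denseRange_ccToOrlicz hΔ).equalizer S.continuous
    S'.continuous (funext h)) g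

/-- Convolution with a function in `C_c(G/H)`, as a linear map to the operators on `L^φ`. -/
noncomputable def convCcExtension (hΔ : DeltaTwo φ m) :
    C_c(G ⧸ H, ℂ) →ₗ[ℂ] orliczSpace φ m →L[ℂ] orliczSpace φ m where
  toFun := convOperator
  map_add' f f' := convOperator_ext hΔ fun g => by
    rw [add_apply, convOperator_apply hΔ, convOperator_apply hΔ,
      convOperator_apply hΔ, map_add, LinearMap.add_apply, map_add]
  map_smul' c f := convOperator_ext hΔ fun g => by
    rw [smul_apply, convOperator_apply hΔ, convOperator_apply hΔ, map_smul,
      LinearMap.smul_apply, map_smul, RingHom.id_apply]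

theorem convCcExtension_apply (hΔ : DeltaTwo φ m) (f g : C_c(G ⧸ H, ℂ)) :
    convCcExtension hΔ f (ccToOrlicz φ m g) = ccToOrlicz φ m (convBilin H m f g) :=
  convOperator_apply hΔ f g

theorem norm_convCcExtension_le (hΔ : DeltaTwo φ m) (f : C_c(G ⧸ H, ℂ)) :
    ‖convCcExtension hΔ f‖ ≤ 1 * ‖ccToL1 m f‖ := by
  rw [one_mul]
  exact LinearMap.opNorm_extendOfNorm_le (f := ccToOrlicz φ m ∘ₗ convBilin H m f)
    (e := ccToOrlicz φ m) (denseRange_ccToOrlicz hΔ) (norm_nonneg _) (norm_ccToOrlicz_conv_le f)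

/-- The extension of the convolution to `L¹ × L^φ`. -/
noncomputable def convExtension (hΔ : DeltaTwo φ m) :
    Lp ℂ 1 m →L[ℂ] orliczSpace φ m →L[ℂ] orliczSpace φ m :=
  (convCcExtension hΔ).extendOfNorm (ccToL1 m)

theorem convExtension_apply (hΔ : DeltaTwo φ m) (f g : C_c(G ⧸ H, ℂ)) :
    convExtension hΔ (ccToL1 m f) (ccToOrlicz φ m g) = ccToOrlicz φ m (convBilin H m f g) := by
  rw [convExtension, LinearMap.extendOfNorm_eq (f := convCcExtension hΔ)
    (e := ccToL1 m) denseRange_ccToL1 ⟨1, norm_convCcExtension_le hΔ⟩,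
    convCcExtension_apply]

theorem continuous_convExtension (hΔ : DeltaTwo φ m) :
    Continuous fun p : Lp ℂ 1 m × orliczSpace φ m => convExtension (H := H) hΔ p.1 p.2 :=
  (convExtension (H := H) hΔ).continuous₂

theorem tendsto_convBilin (hΔ : DeltaTwo φ m) {f : Lp ℂ 1 m} {g : orliczSpace φ m}
    {fn gn : ℕ → C_c(G ⧸ H, ℂ)} (hf : Tendsto (fun n => ccToL1 m (fn n)) atTop (𝓝 f))
    (hg : Tendsto (fun n => ccToOrlicz φ m (gn n)) atTop (𝓝 g)) :
    Tendsto (fun n => ccToOrlicz φ m (convBilin H m (fn n) (gn n))) atTop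
      (𝓝 (convExtension hΔ f g)) := by
  have h := ((continuous_convExtension (H := H) hΔ).tendsto (f, g)).comp (hf.prodMk_nhds hg)
  have e : (fun n => ccToOrlicz φ m (convBilin H m (fn n) (gn n))) =
      fun n => convExtension hΔ (ccToL1 m (fn n)) (ccToOrlicz φ m (gn n)) :=
    funext fun n => (convExtension_apply hΔ _ _).symm
  rw [e]
  exact h

theorem isConvExtension_convExtension (hΔ : DeltaTwo φ m) :
    IsConvExtension H m φ fun f g => convExtension hΔ f g := by
  intro f g fn gn hf hg
  have h := tendsto_convBilin hΔ (tendsto_ccToL1_iff.1 hf) (tendsto_ccToOrlicz_iff.1 hg)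
  have h2 := tendsto_ccToOrlicz_iff.2 h
  exact h2

/-- No linearity or continuity of `B` is needed: every pair is a limit of sequences from `C_c(G/H)`,
and these determine the value. -/
theorem IsConvExtension.unique (hΔ : DeltaTwo φ m)
    {B B' : Lp ℂ 1 m → orliczSpace φ m → orliczSpace φ m}
    (hB : IsConvExtension H m φ B) (hB' : IsConvExtension H m φ B') : B = B' := by
  funext f g
  obtain ⟨u, hu, hut⟩ := mem_closure_iff_seq_limit.1 (denseRange_ccToL1 (m := m) f)
  obtain ⟨v, hv, hvt⟩ := mem_closure_iff_seq_limit.1 (denseRange_ccToOrlicz hΔ g)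
  choose fn hfn using hu
  choose gn hgn using hv
  obtain rfl : (fun n => ccToL1 m (fn n)) = u := funext hfn
  obtain rfl : (fun n => ccToOrlicz φ m (gn n)) = v := funext hgn
  have h1 := hB f g fn gn (tendsto_ccToL1_iff.2 hut) (tendsto_ccToOrlicz_iff.2 hvt)
  have h2 := hB' f g fn gn (tendsto_ccToL1_iff.2 hut) (tendsto_ccToOrlicz_iff.2 hvt)
  exact tendsto_nhds_unique
    ((tendsto_ccToOrlicz_iff (k := fun n => convBilin H m (fn n) (gn n))).1 h1)
    ((tendsto_ccToOrlicz_iff (k := fun n => convBilin H m (fn n) (gn n))).1 h2)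

theorem IsAverageExtension.ae_tendsto {T : orliczSpace φ m →ₗ[ℂ] orliczSpace φ m}
    (hT : IsAverageExtension H m φ T) {g : orliczSpace φ m} {gn : ℕ → C_c(G ⧸ H, ℂ)}
    (hgn : ∑' n, elux φ m (fun z => ‖gn n z - g.1 z‖ₑ) ≠ ∞) :
    ∀ᵐ z ∂m, Tendsto (fun n => average H (gn n) z) atTop (𝓝 ((T g).1 z)) := by
  obtain ⟨C, hC⟩ := hT.elux_sub_le
  refine ae_tendsto_of_tsum_elux_ne_top (φ := φ)
    (fun n => (averageCc H (gn n)).continuous.measurable.aestronglyMeasurable)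
    (T g).1.aestronglyMeasurable (ne_top_of_le_ne_top ?_ (ENNReal.tsum_le_tsum fun n => hC _ g))
  rw [ENNReal.tsum_mul_left]
  exact ENNReal.mul_ne_top ENNReal.coe_ne_top hgn

theorem IsAverageExtension.exists_leftInvariant (hΔ : DeltaTwo φ m)
    {T : orliczSpace φ m →ₗ[ℂ] orliczSpace φ m} (hT : IsAverageExtension H m φ T)
    (g : orliczSpace φ m) : ∃ F : G ⧸ H → ℂ, LeftInvariant H F ∧ F =ᵐ[m] (T g).1 := by
  obtain ⟨gn, hgn⟩ := exists_seq_tsum_elux_sub_ne_top hΔ g.1.aestronglyMeasurable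
    (elux_coe_lt_top g)
  -- The sequence is the same at `z` and `hz`, so the value of `limUnder` is too, even where there
  -- is no limit. The function is thus invariant everywhere, not only almost everywhere.
  refine ⟨fun z => limUnder atTop fun n => average H (gn n) z, fun h z => ?_, ?_⟩
  · simp only [average_leftInvariant H _ h z]
  · filter_upwards [hT.ae_tendsto hgn] with z hz
    exact hz.limUnder_eq

theorem continuous_lintegral_translate (f F : C_c(G ⧸ H, ℂ)) (hF : LeftInvariant H F) :
    Continuous fun z => ∫⁻ w, ‖f w‖ₑ * ‖translate H F hF z w‖ₑ ∂m := by
  have e : ∀ z, ∫⁻ w, ‖f w‖ₑ * ‖translate H F hF z w‖ₑ ∂m =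
      ENNReal.ofReal (∫ w, ‖f w * translate H F hF z w‖ ∂m) := fun z => by
    rw [ofReal_integral_norm_eq_lintegral_enorm (integrable_mul_translate f F hF z)]
    simp only [enorm_mul]
  simp only [e]
  refine ENNReal.continuous_ofReal.comp (continuous_integral_of_uncurry
    (f := fun z w => ‖f w * translate H F hF z w‖) ?_ f.hasCompactSupport fun z w hw => ?_)
  · exact ((f.continuous.comp continuous_snd).mul
      ((continuous_translate hF F.continuous).comp continuous_swap)).norm
  · simp [image_eq_zero_of_notMem_tsupport hw]

/-- By Young's inequality for each pair, the norm of the double series is at most `(∑ ‖f i‖₁) (∑ ‖F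
j‖)`, hence the series is finite almost everywhere. It provides the majorant for the integral
formula. -/
theorem ae_lintegral_tsum_translate_lt_top {f F : ℕ → C_c(G ⧸ H, ℂ)}
    (hF : ∀ j, LeftInvariant H (F j)) (hf : ∑' i, ∫⁻ w, ‖f i w‖ₑ ∂m ≠ ∞)
    (hFs : ∑' j, elux φ m (fun z => ‖F j z‖ₑ) ≠ ∞) :
    ∀ᵐ z ∂m, ∫⁻ w, ∑' p : ℕ × ℕ, ‖f p.1 w‖ₑ * ‖translate H (F p.2) (hF p.2) z w‖ₑ ∂m < ∞ := by
  have hmeas : ∀ p : ℕ × ℕ, AEMeasurable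
      (fun z => ∫⁻ w, ‖f p.1 w‖ₑ * ‖translate H (F p.2) (hF p.2) z w‖ₑ ∂m) m := fun p =>
    (continuous_lintegral_translate _ _ _).measurable.aemeasurable
  have h : elux φ m (fun z => ∑' p : ℕ × ℕ,
      ∫⁻ w, ‖f p.1 w‖ₑ * ‖translate H (F p.2) (hF p.2) z w‖ₑ ∂m) < ∞ := by
    refine lt_of_le_of_lt ((elux_tsum_le hmeas).trans (ENNReal.tsum_le_tsum fun p =>
      elux_lintegral_translate_le (f p.1) (F p.2) (hF p.2))) ?_
    rw [ENNReal.tsum_prod']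
    simp only [ENNReal.tsum_mul_left, ENNReal.tsum_mul_right]
    exact ENNReal.mul_lt_top (lt_top_iff_ne_top.2 hf) (lt_top_iff_ne_top.2 hFs)
  filter_upwards [ae_lt_top_of_elux_lt_top (AEMeasurable.tsum hmeas) h] with z hz
  rwa [lintegral_tsum fun p => ?_]
  exact (((f p.1).continuous.measurable.enorm).mul (((continuous_translate (hF p.2)
    (F p.2).continuous).comp (Continuous.prodMk_left z)).measurable.enorm)).aemeasurable

/-- The representation of the extended convolution by an integral. -/
theorem IsConvExtension.ae_eq_integral {μ : Measure G} [μ.IsHaarMeasure] [μ.Regular]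
    (hm : WeilFormula μ H m) (hΔ : DeltaTwo φ m)
    {T : orliczSpace φ m →ₗ[ℂ] orliczSpace φ m} (hT : IsAverageExtension H m φ T)
    {B : Lp ℂ 1 m → orliczSpace φ m → orliczSpace φ m} (hB : IsConvExtension H m φ B)
    (f : Lp ℂ 1 m) (g : orliczSpace φ m) {F : G ⧸ H → ℂ} (hF : LeftInvariant H F)
    (hFT : F =ᵐ[m] (T g).1) :
    ∀ᵐ z ∂m, Integrable (fun w => f w * translate H F hF z w) m ∧
      (B f g).1 z = ∫ w, f w * translate H F hF z w ∂m := by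
  obtain ⟨gn, hgn⟩ := exists_seq_tsum_elux_sub_ne_top hΔ g.1.aestronglyMeasurable
    (elux_coe_lt_top g)
  obtain ⟨fn, hfn⟩ := exists_seq_tsum_elux_sub_ne_top (deltaTwo_absYoung m)
    (Lp.aestronglyMeasurable f) (elux_absYoung_Lp_lt_top f)
  have hf_ae : ∀ᵐ w ∂m, Tendsto (fun n => fn n w) atTop (𝓝 (f w)) :=
    ae_tendsto_of_tsum_elux_ne_top (φ := absYoung)
      (fun n => (fn n).continuous.measurable.aestronglyMeasurable) (Lp.aestronglyMeasurable f) hfn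
  have hF_ae : ∀ᵐ z ∂m, Tendsto (fun n => averageCc H (gn n) z) atTop (𝓝 (F z)) := by
    filter_upwards [hT.ae_tendsto hgn, hFT] with z h1 h2
    rwa [h2]
  have hconv : Tendsto (fun n => luxemburgNorm φ m
      (fun z => conv H m (fn n) (gn n) z - (B f g).1 z)) atTop (𝓝 0) := by
    refine hB f g fn gn ?_ ?_
    · simp only [eLpNorm_one_eq_lintegral_enorm, ← elux_absYoung]
      exact ENNReal.tendsto_atTop_zero_of_tsum_ne_top hfn
    · simp only [luxemburgNorm_eq_elux]
      exact ENNReal.tendsto_atTop_zero_of_tsum_ne_top hgn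
  -- The convolutions converge to `B f g` in norm; a subsequence with summable errors converges
  -- almost everywhere.
  obtain ⟨ε, hε, hεsum⟩ := ENNReal.exists_pos_sum_of_countable' one_ne_zero ℕ
  obtain ⟨ns, hns, hnsε⟩ := extraction_forall_of_eventually fun n =>
    hconv.eventually (ge_mem_nhds (hε n))
  have hB_ae : ∀ᵐ z ∂m, Tendsto (fun n => convBilin H m (fn (ns n)) (gn (ns n)) z) atTop
      (𝓝 ((B f g).1 z)) := by
    refine ae_tendsto_of_tsum_elux_ne_top (φ := φ)
      (fun n => (convBilin H m _ _).continuous.measurable.aestronglyMeasurable)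
      (B f g).1.aestronglyMeasurable (ne_top_of_le_ne_top ENNReal.one_ne_top
        ((ENNReal.tsum_le_tsum fun n => ?_).trans hεsum.le))
    simp only [convBilin_apply, ← luxemburgNorm_eq_elux]
    exact hnsε n
  have hfinite := ae_lintegral_tsum_translate_lt_top (φ := φ) (m := m) (f := increments fn)
    (F := fun j => averageCc H (increments gn j)) (fun j => averageCc_leftInvariant H _)
    (by
      have := tsum_elux_increments_ne_top (Lp.aestronglyMeasurable f) hfn
      simpa only [elux_absYoung] using this)
    (ne_top_of_le_ne_top (tsum_elux_increments_ne_top g.1.aestronglyMeasurable hgn)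
      (ENNReal.tsum_le_tsum fun j => elux_average_le _))
  filter_upwards [hB_ae, hfinite] with z hBz hz
  set b : G ⧸ H → ℝ≥0∞ := fun w => ∑' p : ℕ × ℕ, ‖increments fn p.1 w‖ₑ *
    ‖translate H (averageCc H (increments gn p.2)) (averageCc_leftInvariant H _) z w‖ₑ with hb
  let κ : ℕ → G ⧸ H → ℂ := fun n => translate H (averageCc H (gn n)) (averageCc_leftInvariant H _) z
  -- For the fixed `z`, the null set where `J gn` fails to converge to `F` is carried by `y ↦ y⁻¹z`
  -- to a null set of cosets `yH`.
  have hlim : ∀ᵐ w ∂m, Tendsto (fun n => fn n w * κ n w) atTop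
      (𝓝 (f w * translate H F hF z w)) := by
    filter_upwards [hf_ae, hm.ae_of_ae_inv_smul hF_ae z
      (r := fun w => Tendsto (fun n => κ n w) atTop (𝓝 (translate H F hF z w)))
      (fun y h => h)] with w h1 h2
    exact h1.mul h2
  -- Both factors are partial sums of increments, so their product is a finite part of the double
  -- series `b`.
  have hbound : ∀ n w, ‖fn n w * κ n w‖ₑ ≤ b w := by
    intro n w
    have h1 : fn n w = ∑ i ∈ Finset.range (n + 1), increments fn i w := by
      conv_lhs => rw [← sum_increments fn n]
      rw [CompactlySupportedContinuousMap.sum_apply]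
    have h2 : κ n w = ∑ j ∈ Finset.range (n + 1), translate H (averageCc H (increments gn j))
        (averageCc_leftInvariant H _) z w := by
      induction w using QuotientGroup.induction_on with
      | H y =>
        simp only [κ, translate_coe]
        conv_lhs => rw [← sum_increments gn n, map_sum]
        rw [CompactlySupportedContinuousMap.sum_apply]
    rw [h1, h2, Finset.sum_mul_sum, ← Finset.sum_product']
    refine (enorm_sum_le _ _).trans ?_
    simp only [enorm_mul]
    exact ENNReal.sum_le_tsum _
  have hbm : Measurable b := Measurable.tsum fun p =>
    ((increments fn p.1).continuous.measurable.enorm).mul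
      (((continuous_translate (averageCc_leftInvariant H _)
        (averageCc H (increments gn p.2)).continuous).comp
          (Continuous.prodMk_left z)).measurable.enorm)
  have hbi : Integrable (fun w => (b w).toReal) m :=
    integrable_toReal_of_lintegral_ne_top hbm.aemeasurable hz.ne
  have hmeas : ∀ n, AEStronglyMeasurable (fun w => fn n w * κ n w) m := fun n =>
    (integrable_mul_translate (fn n) (averageCc H (gn n)) _ z).1
  have hbn : ∀ n, ∀ᵐ w ∂m, ‖fn n w * κ n w‖ ≤ (b w).toReal := by
    intro n
    filter_upwards [ae_lt_top hbm hz.ne] with w hw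
    rw [← toReal_enorm]
    exact ENNReal.toReal_mono hw.ne (hbound n w)
  refine ⟨?_, ?_⟩
  · exact ⟨aestronglyMeasurable_of_tendsto_ae atTop hmeas hlim,
      hasFiniteIntegral_of_dominated_convergence hbi.2 hbn hlim⟩
  · have h1 := tendsto_integral_of_dominated_convergence (fun w => (b w).toReal) hmeas hbi hbn hlim
    exact tendsto_nhds_unique hBz (h1.comp hns.tendsto_atTop)

end Coset

end OrliczCoset

theorem corollary3p7 {G : Type*} [Group G] [TopologicalSpace G] [IsTopologicalGroup G]
    [LocallyCompactSpace G] [T2Space G] [MeasurableSpace G] [BorelSpace G]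
    (μ : Measure G) [μ.IsHaarMeasure] [μ.Regular]
    (H : Subgroup G) [CompactSpace H] [MeasurableSpace (G ⧸ H)] [BorelSpace (G ⧸ H)]
    (m : Measure (G ⧸ H)) [m.Regular] [SMulInvariantMeasure G (G ⧸ H) m]
    (hm : OrliczCoset.WeilFormula μ H m)
    (φ : OrliczCoset.YoungFunction) (hfin : ∀ x, φ.toFun x ≠ ∞)
    (hΔ : OrliczCoset.DeltaTwo φ m) :
    -- the extension `J_φ` of `J` and the extended convolution exist and are unique
    (∃! T : OrliczCoset.orliczSpace φ m →ₗ[ℂ] OrliczCoset.orliczSpace φ m,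
      OrliczCoset.IsAverageExtension H m φ T) ∧
    (∃! B : Lp ℂ 1 m → OrliczCoset.orliczSpace φ m → OrliczCoset.orliczSpace φ m,
      OrliczCoset.IsConvExtension H m φ B) ∧
    -- and the extended convolution is given by the formula
    ∀ (Jφ : OrliczCoset.orliczSpace φ m →ₗ[ℂ] OrliczCoset.orliczSpace φ m)
      (B : Lp ℂ 1 m → OrliczCoset.orliczSpace φ m → OrliczCoset.orliczSpace φ m),
      OrliczCoset.IsAverageExtension H m φ Jφ → OrliczCoset.IsConvExtension H m φ B →
      ∀ (f : Lp ℂ 1 m) (g : OrliczCoset.orliczSpace φ m),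
        -- `J_φ g` has a left `H`-invariant representative
        (∃ F : G ⧸ H → ℂ, OrliczCoset.LeftInvariant H F ∧ F =ᵐ[m] (Jφ g).1) ∧
        -- and the formula holds for each of them
        ∀ (F : G ⧸ H → ℂ) (hF : OrliczCoset.LeftInvariant H F), F =ᵐ[m] (Jφ g).1 →
          ∀ᵐ z ∂m,
            Integrable (fun w => f w * OrliczCoset.translate H F hF z w) m ∧
            (B f g).1 z = ∫ w, f w * OrliczCoset.translate H F hF z w ∂m := by
  have : φ.Finite := ⟨hfin⟩
  refine ⟨⟨_, OrliczCoset.isAverageExtension_averageExtension hΔ, fun T hT =>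
      hT.unique hΔ (OrliczCoset.isAverageExtension_averageExtension hΔ)⟩,
    ⟨_, OrliczCoset.isConvExtension_convExtension hΔ, fun B hB =>
      hB.unique hΔ (OrliczCoset.isConvExtension_convExtension hΔ)⟩,
    fun Jφ B hJ hB f g => ⟨hJ.exists_leftInvariant hΔ g, fun F hF hFJ => ?_⟩⟩
  exact hB.ae_eq_integral hm hΔ hJ f g hF hFJ
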